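/- Let $M$ be a compact connected smooth Riemannian manifold of dimension $m$, and let $G$ be a compact Lie group acting smoothly, transitively and isometrically on $M$. Assume that $M$ is isotropy irreducible: for a base point $o\in M$ with stabilizer $H$, the only $H$-invariant linear subspaces of $T_oM$ are $0$ and $T_oM$. Equip $M$ with the $G$-invariant Borel probability measure $dp$; $L^a(M)$ (real-valued functions) and its norm $\|\cdot\|_a$ refer to this measure. Let $\mathcal E$ denote a nonzero finite-dimensional $G$-invariant linear subspace of $L^2(M)$ that is orthogonal to the constant function $1$. Let $\mathcal S$ be the unit sphere of $\mathcal E$ and let $\mathsf M(f)=\int_{\mathcal S}f(u)\,du$, where $du$ is the rotation invariant probability measure on $\mathcal S$. Elements of $\mathcal E$ have continuous representatives. For $p\in M$ let $\phi_p\in\mathcal E$ be the vector with $\langle u,\phi_p\rangle=u(p)$ for all $u\in\mathcal E$, and put $\iota(p)=\phi_p/|\phi_p|$. (1) Let $\mathcal E_n$ be a sequence of such spaces with $\dim\mathcal E_n\to\infty$, and let $\mathsf M_n$ be the average over the unit sphere of $\mathcal E_n$. Then for every real $a>-1$ $$\lim_{n\to\infty}\mathsf M_n\Big(\int_M|u(p)|^a\,dp\Big)=\frac{2^{a/2}}{\sqrt\pi}\,\Gamma\Big(\frac{a+1}2\Big),$$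 and for every real $a\ge1$ $$\limsup_{n\to\infty}\mathsf M_n(\|u\|_a)\le\sqrt2\,\pi^{-\frac1{2a}}\,\Gamma\Big(\frac{a+1}2\Big)^{\frac1a}<\sqrt{\frac{a+1}e}.$$ (2) For every such space $\mathcal E$ and every real $a\ge2$, $$\mathsf M(\|u\|_a)<\sqrt{\frac{a+1}e}.$$ (3) There is a constant $K>0$ (depending on $M$ with its metric and group action, but not on $\mathcal E$) such that for every such space $\mathcal E$ the following holds. The map $\iota$ is differentiable and is an infinitesimal homothety: there is a number $s=s(\mathcal E)$ with $|d_p\iota(v)|=s|v|$ for all $p\in M$ and $v\in T_pM$. With $c=\sqrt{\dim\mathcal E}$ and $\kappa=cs$, $$\mathsf M(\|u\|_\infty)<K\big(\sqrt{\max(\ln\kappa,0)}+1\big).$$ -/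

import Mathlib

open MeasureTheory Filter Topology Manifold Bundle
open scoped ENNReal ContDiff

noncomputable section

/-- `G` acts by Riemannian isometries: the differential of each `p ↦ g • p` is a linear isometry
between tangent spaces. -/
def ActsByIsometries (m : ℕ) (G M : Type*) [TopologicalSpace M]
    [ChartedSpace (EuclideanSpace ℝ (Fin m)) M] [IsManifold (𝓡 m) ∞ M]
    [RiemannianBundle (fun p : M => TangentSpace (𝓡 m) p)] [SMul G M] : Prop :=
  ∀ (g : G) (p : M) (v : TangentSpace (𝓡 m) p),
    ‖mfderiv (𝓡 m) (𝓡 m) (fun q : M => g • q) p v‖ = ‖v‖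

/-- The isotropy representation of the stabilizer of `o` on `T_o M` has no invariant linear
subspaces except `0` and `T_o M`. For `h` in the stabilizer, the differential of `p ↦ h • p` at `o`
takes values in `T_{h • o} M = T_o M`. -/
def IsotropyIrreducible (m : ℕ) (G : Type*) {M : Type*} [TopologicalSpace M]
    [ChartedSpace (EuclideanSpace ℝ (Fin m)) M] [Group G] [MulAction G M] (o : M) : Prop :=
  ∀ W : Submodule ℝ (TangentSpace (𝓡 m) o),
    (∀ h ∈ MulAction.stabilizer G o, ∀ w ∈ W,
      (mfderiv (𝓡 m) (𝓡 m) (fun q : M => h • q) o w : TangentSpace (𝓡 m) o) ∈ W) →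
    W = ⊥ ∨ W = ⊤

/-- A nonzero finite dimensional `G`-invariant linear subspace `E` of the real space `L²(M, μ)`,
orthogonal to the constant function `1`. -/
structure InvSpace (G : Type*) {M : Type*} [SMul G M] [MeasurableSpace M] (μ : Measure M) where
  carrier : Submodule ℝ (Lp ℝ 2 μ)
  finiteDimensional : FiniteDimensional ℝ carrier
  invariant : ∀ (g : G), ∀ u ∈ carrier, ∃ v ∈ carrier, v =ᵐ[μ] fun p => u (g • p)
  integral_eq_zero : ∀ u ∈ carrier, ∫ p, u p ∂μ = 0
  ne_bot : carrier ≠ ⊥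

attribute [instance] InvSpace.finiteDimensional

/-- The average of `f` over the unit sphere of a finite dimensional Euclidean space `V`, with
respect to the normalized rotation invariant measure. -/
def sphereMean {V : Type*} [NormedAddCommGroup V] [InnerProductSpace ℝ V] [FiniteDimensional ℝ V]
    (f : V → ℝ≥0∞) : ℝ≥0∞ :=
  letI : MeasurableSpace V := borel V
  haveI : BorelSpace V := ⟨rfl⟩
  ⨍⁻ u : Metric.sphere (0 : V) 1, f u ∂(volume : Measure V).toSphere

namespace InvSpace

variable {G M : Type*} [SMul G M] [TopologicalSpace M] [MeasurableSpace M] {μ : Measure M}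

/-- `dim E`. -/
def dim (E : InvSpace G μ) : ℕ := Module.finrank ℝ E.carrier

/-- The average of `f` over the unit sphere of `E` (in the `L²` norm). -/
def mean (E : InvSpace G μ) (f : Lp ℝ 2 μ → ℝ≥0∞) : ℝ≥0∞ :=
  sphereMean (fun u : E.carrier => f u)

open scoped Classical in
/-- The map `p ↦ φ_p ∈ E` representing the evaluation functionals, `u(p) = ⟪φ_p, u⟫` for `u ∈ E`.
Here `u(p)` is the value at `p` of the continuous representative of the class `u`. -/
def evalVec (E : InvSpace G μ) : M → E.carrier :=
  if h : ∃ Φ : M → E.carrier, ∀ u : E.carrier,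
      Continuous (fun p => inner ℝ (Φ p) u) ∧
      (u : Lp ℝ 2 μ) =ᵐ[μ] fun p => inner ℝ (Φ p) u
  then h.choose else 0

/-- The map `ι : M → E`, `ι(p) = φ_p / |φ_p|`, into the unit sphere of `E`. -/
def iota (E : InvSpace G μ) (p : M) : E.carrier := ‖E.evalVec p‖⁻¹ • E.evalVec p

/-- `ι` is differentiable and infinitesimally multiplies lengths by `s`:
`|d_p ι (v)| = s |v|` for all `p ∈ M` and `v ∈ T_p M`. -/
def IsDilationCoeff (m : ℕ) [ChartedSpace (EuclideanSpace ℝ (Fin m)) M] [IsManifold (𝓡 m) ∞ M]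
    [RiemannianBundle (fun p : M => TangentSpace (𝓡 m) p)] (E : InvSpace G μ) (s : ℝ) : Prop :=
  MDifferentiable (𝓡 m) 𝓘(ℝ, E.carrier) E.iota ∧
  ∀ (p : M) (v : TangentSpace (𝓡 m) p),
    let w : E.carrier := mfderiv (𝓡 m) 𝓘(ℝ, E.carrier) E.iota p v
    ‖w‖ = s * ‖v‖

end InvSpace

end

/-! Evaluation at `p` is the inner product with a vector `φ_p` of `E`. Transitivity makes `|φ_p|`
constant, and integrating over `M` gives `|φ_p|² = dim E` (`InvSpace.norm_evalVec`). By Fubini the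
mean of `∫ |u|^a` is therefore the `a`-th moment of one coordinate on the sphere of radius `√(dim
E)`, an explicit quotient of Gamma values (`laverage_toSphere_inner_rpow`, `sphereMoment`).

Asymptotics of `Γ(y + b) / Γ(y)` turn this moment into the Gaussian one in the limit, while
log-convexity of `Γ` bounds it by the Gaussian one when `a ≥ 2`. Jensen's inequality passes from
moments to norms, and a Stirling-type bound (`Real.log_Gamma_lt`) compares the Gaussian norm with
`√((a + 1) / e)`.

For the sup norm, `ι` is equivariant, hence `C¹` (`contMDiff_of_equivariant`), and Schur's lemma for
the irreducible isotropy representation makes it an infinitesimal homothety. So `p ↦ φ_p` is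
`κ`-Lipschitz. A net of mesh about `1/κ` has `N = O(κ^m)` points for large `κ`, and off the net `u`
changes by at most `1`. The expected maximum over the net is at most `N^(1/a)` times the `L^a`
bound; taking `a` slightly above `log N` makes the first factor at most `e` and the second of order
`√(log κ)`. -/

/-! ### Ratios of Gamma values -/

theorem Real.rpow_mul_Gamma_le_Gamma_add {y b : ℝ} (hy : 0 < y) (hb : 1 ≤ b) :
    y ^ b * Real.Gamma y ≤ Real.Gamma (y + b) := by
  rcases hb.eq_or_lt with rfl | hb
  · rw [Real.Gamma_add_one hy.ne', Real.rpow_one]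
  have hb0 : 0 < b := by linarith
  have hG := Real.Gamma_pos_of_pos hy
  have hG' := Real.Gamma_pos_of_pos (add_pos hy hb0)
  have hib : 0 < 1 - 1 / b := by
    rw [sub_pos, div_lt_one hb0]; exact hb
  -- Since `b > 1`, the point `y + 1` lies between `y` and `y + b`, and `Γ(y + 1) = y Γ(y)`.
  have h := Real.Gamma_mul_add_mul_le_rpow_Gamma_mul_rpow_Gamma hy (add_pos hy hb0)
    hib (one_div_pos.2 hb0) (by ring)
  have e : (1 - 1 / b) * y + 1 / b * (y + b) = y + 1 := by field_simp; ring
  rw [e, Real.Gamma_add_one hy.ne', Real.rpow_sub hG, Real.rpow_one] at h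
  have hp : 0 < Real.Gamma y ^ (1 / b) := Real.rpow_pos_of_pos hG _
  have h2 : y * Real.Gamma y ^ (1 / b) ≤ Real.Gamma (y + b) ^ (1 / b) := by
    have h3 : y * Real.Gamma y ≤ Real.Gamma y *
        (Real.Gamma (y + b) ^ (1 / b) / Real.Gamma y ^ (1 / b)) := by
      calc _ ≤ _ := h
        _ = _ := by ring
    rw [mul_comm y, mul_le_mul_iff_right₀ hG, le_div_iff₀ hp] at h3
    exact h3
  have h4 := Real.rpow_le_rpow (by positivity) h2 hb0.le
  rwa [Real.mul_rpow hy.le hp.le, ← Real.rpow_mul hG.le, ← Real.rpow_mul hG'.le,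
    one_div_mul_cancel hb0.ne', Real.rpow_one, Real.rpow_one] at h4

/-- For `b < 1` the point `y + b` is the one in the middle, between `y` and `y + 1`, so
log-convexity yields the opposite inequality. -/
theorem Real.Gamma_add_le_rpow_mul_Gamma {y b : ℝ} (hy : 0 < y) (hb : 0 < b) (hb1 : b < 1) :
    Real.Gamma (y + b) ≤ y ^ b * Real.Gamma y := by
  have hG := Real.Gamma_pos_of_pos hy
  have h := Real.Gamma_mul_add_mul_le_rpow_Gamma_mul_rpow_Gamma hy (add_pos hy one_pos)
    (sub_pos.2 hb1) hb (by ring)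
  have e : (1 - b) * y + b * (y + 1) = y + b := by ring
  rw [e, Real.Gamma_add_one hy.ne', Real.mul_rpow hy.le hG.le] at h
  calc _ ≤ _ := h
    _ = y ^ b * (Real.Gamma y ^ (1 - b) * Real.Gamma y ^ b) := by ring
    _ = _ := by rw [← Real.rpow_add hG, sub_add_cancel, Real.rpow_one]

theorem Real.tendsto_rpow_mul_Gamma_div_Gamma_add_of_lt_one {b : ℝ} (hb : 0 < b) (hb1 : b < 1) :
    Tendsto (fun y : ℝ => y ^ b * Real.Gamma y / Real.Gamma (y + b)) atTop (𝓝 1) := by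
  have hlim : Tendsto (fun y : ℝ => (1 + b / y) ^ (1 - b)) atTop (𝓝 1) := by
    have : Tendsto (fun y : ℝ => 1 + b / y) atTop (𝓝 (1 + 0)) :=
      tendsto_const_nhds.add (tendsto_const_nhds.div_atTop tendsto_id)
    simpa using this.rpow_const (p := 1 - b) (by norm_num)
  refine tendsto_of_tendsto_of_tendsto_of_le_of_le' tendsto_const_nhds hlim ?_ ?_
  · filter_upwards [eventually_gt_atTop 0] with y hy
    rw [le_div_iff₀ (Real.Gamma_pos_of_pos (by positivity)), one_mul]
    exact Real.Gamma_add_le_rpow_mul_Gamma hy hb hb1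
  · filter_upwards [eventually_gt_atTop 0] with y hy
    have hyb : 0 < y + b := by positivity
    rw [div_le_iff₀ (Real.Gamma_pos_of_pos hyb)]
    -- Based at `y + b` with increment `1 - b`, the upper bound ends at `y + 1` and becomes a lower
    -- bound for `Γ(y + b)`.
    have h := Real.Gamma_add_le_rpow_mul_Gamma hyb (sub_pos.2 hb1) (by linarith : 1 - b < 1)
    rw [show y + b + (1 - b) = y + 1 by ring, Real.Gamma_add_one hy.ne'] at h
    have e : 1 + b / y = (y + b) / y := by field_simp
    rw [e, Real.div_rpow hyb.le hy.le, div_mul_eq_mul_div, le_div_iff₀ (by positivity)]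
    calc y ^ b * Real.Gamma y * y ^ (1 - b) = y ^ b * y ^ (1 - b) * Real.Gamma y := by ring
      _ = y * Real.Gamma y := by rw [← Real.rpow_add hy]; simp
      _ ≤ _ := h

/-- The two quotients differ by the factor `1 + b / y`, which tends to `1`. The shift up drives an
induction from `[0, 1)`; the shift down reaches `-1 < b < 0`. -/
theorem Real.tendsto_rpow_mul_Gamma_div_Gamma_add_add_one_iff {b : ℝ} :
    Tendsto (fun y : ℝ => y ^ (b + 1) * Real.Gamma y / Real.Gamma (y + (b + 1))) atTop (𝓝 1) ↔
      Tendsto (fun y : ℝ => y ^ b * Real.Gamma y / Real.Gamma (y + b)) atTop (𝓝 1) := by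
  have h1 : Tendsto (fun y : ℝ => 1 + b / y) atTop (𝓝 1) := by
    have : Tendsto (fun y : ℝ => 1 + b / y) atTop (𝓝 (1 + 0)) :=
      tendsto_const_nhds.add (tendsto_const_nhds.div_atTop tendsto_id)
    simpa using this
  have h2 : Tendsto (fun y : ℝ => (1 + b / y)⁻¹) atTop (𝓝 1) := by
    simpa using h1.inv₀ one_ne_zero
  have key : ∀ᶠ y : ℝ in atTop, y ^ (b + 1) * Real.Gamma y / Real.Gamma (y + (b + 1)) =
      y ^ b * Real.Gamma y / Real.Gamma (y + b) * (1 + b / y)⁻¹ ∧ 1 + b / y ≠ 0 := by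
    filter_upwards [eventually_gt_atTop 0, eventually_gt_atTop (-b)] with y hy hyb
    have hyb' : 0 < y + b := by linarith
    have e : 1 + b / y = (y + b) / y := by field_simp
    have := (Real.Gamma_pos_of_pos hyb').ne'
    refine ⟨?_, by rw [e]; positivity⟩
    rw [← add_assoc, Real.Gamma_add_one hyb'.ne', Real.rpow_add_one hy.ne', e]
    field_simp
  constructor
  · intro h
    have h3 := h.mul h1
    rw [one_mul] at h3
    refine h3.congr' ?_
    filter_upwards [key] with y hy
    rw [hy.1, inv_mul_cancel_right₀ hy.2]
  · intro h
    have h3 := h.mul h2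
    rw [one_mul] at h3
    refine h3.congr' ?_
    filter_upwards [key] with y hy
    rw [hy.1]

theorem Real.tendsto_rpow_mul_Gamma_div_Gamma_add {b : ℝ} (hb : -1 < b) :
    Tendsto (fun y : ℝ => y ^ b * Real.Gamma y / Real.Gamma (y + b)) atTop (𝓝 1) := by
  have base : ∀ c : ℝ, 0 ≤ c → c < 1 →
      Tendsto (fun y : ℝ => y ^ c * Real.Gamma y / Real.Gamma (y + c)) atTop (𝓝 1) := by
    intro c hc hc1
    rcases hc.eq_or_lt with rfl | hc
    · refine tendsto_const_nhds.congr' ?_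
      filter_upwards [eventually_gt_atTop 0] with y hy
      simp [(Real.Gamma_pos_of_pos hy).ne']
    · exact Real.tendsto_rpow_mul_Gamma_div_Gamma_add_of_lt_one hc hc1
  have step : ∀ (n : ℕ) (c : ℝ), 0 ≤ c → c < 1 →
      Tendsto (fun y : ℝ => y ^ (c + n) * Real.Gamma y / Real.Gamma (y + (c + n))) atTop (𝓝 1) := by
    intro n c hc hc1
    induction n with
    | zero => simpa using base c hc hc1
    | succ n ih =>
      have := Real.tendsto_rpow_mul_Gamma_div_Gamma_add_add_one_iff.2 ih
      simpa [add_assoc] using this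
  rw [← Real.tendsto_rpow_mul_Gamma_div_Gamma_add_add_one_iff]
  have h := step ⌊b + 1⌋₊ (Int.fract (b + 1)) (Int.fract_nonneg _) (Int.fract_lt_one _)
  have e : Int.fract (b + 1) + (⌊b + 1⌋₊ : ℝ) = b + 1 := by
    have h0 : (0 : ℝ) ≤ b + 1 := by linarith
    rw [natCast_floor_eq_intCast_floor h0, Int.fract_add_floor]
  rwa [e] at h

/-! ### A Stirling-type upper bound for `log Γ` -/

/-- Half of `log π`, to the precision needed for the estimate of `Γ` on `[1, 2]`. -/
theorem Real.half_log_pi_bounds : 0.54 < Real.log Real.pi / 2 ∧ Real.log Real.pi / 2 < 0.58 := by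
  constructor
  · have h : Real.exp 1.08 < Real.pi := by
      have h1 : Real.exp 1.08 = (Real.exp 0.54) ^ 2 := by rw [← Real.exp_nat_mul]; norm_num
      have h2 : Real.exp 0.54 < 1.72 := by
        have := Real.exp_bound' (x := 0.54) (by norm_num) (by norm_num) (n := 6) (by norm_num)
        refine this.trans_lt ?_
        norm_num [Finset.sum_range_succ, Nat.factorial]
      have h3 := Real.exp_pos 0.54
      have := Real.pi_gt_three
      nlinarith
    have := (Real.lt_log_iff_exp_lt Real.pi_pos).2 h
    linarith
  · have h : Real.pi < Real.exp 1.16 := by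
      have h1 : Real.exp 1.16 = (Real.exp 0.58) ^ 2 := by rw [← Real.exp_nat_mul]; norm_num
      have h2 : 1.78 < Real.exp 0.58 := by
        have := Real.sum_le_exp_of_nonneg (x := 0.58) (by norm_num) 5
        refine lt_of_lt_of_le ?_ this
        norm_num [Finset.sum_range_succ, Nat.factorial]
      have := Real.pi_lt_d2
      nlinarith
    have := (Real.log_lt_iff_lt_exp Real.pi_pos).2 h
    linarith

theorem Real.log_Gamma_three_half_lt : Real.log (Real.Gamma (3 / 2)) < -0.11 := by
  have h : Real.Gamma (3 / 2) = √Real.pi / 2 := by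
    rw [show (3 / 2 : ℝ) = 1 / 2 + 1 by norm_num, Real.Gamma_add_one (by norm_num),
      Real.Gamma_one_half_eq]
    ring
  rw [h, Real.log_div (by positivity) (by norm_num), Real.log_sqrt Real.pi_pos.le]
  have := Real.half_log_pi_bounds.2
  have := Real.log_two_gt_d9
  linarith

/-- By convexity `log Γ` lies below its chords joining `3/2` to `1` and to `2`, where it vanishes.
On the right side `log x ≥ 2 (x - 1) / (x + 1)` leaves a rational function. -/
theorem Real.log_Gamma_lt_of_mem_Icc {x : ℝ} (h1 : 1 ≤ x) (h2 : x ≤ 2) :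
    Real.log (Real.Gamma x) < Real.log Real.pi / 2 + (x - 1 / 2) * (Real.log x - 1) := by
  have hpi := Real.half_log_pi_bounds.1
  have hG := Real.log_Gamma_three_half_lt
  have hconv := Real.convexOn_log_Gamma
  have hx : 0 < x := by linarith
  have hlog : 2 * (x - 1) / (x + 1) ≤ Real.log x := by
    have := Real.le_log_one_add_of_nonneg (x := x - 1) (by linarith)
    rwa [show x - 1 + 2 = x + 1 by ring, add_sub_cancel] at this
  have hmul : (x - 1 / 2) * (2 * (x - 1) / (x + 1) - 1) ≤ (x - 1 / 2) * (Real.log x - 1) :=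
    mul_le_mul_of_nonneg_left (by linarith) (by linarith)
  have e : (x - 1 / 2) * (2 * (x - 1) / (x + 1) - 1) =
      -1 / 2 + (x - 1) * (x - 2) / (x + 1) := by field_simp; ring
  rcases le_total x (3 / 2) with h | h
  · have hc : Real.log (Real.Gamma x) ≤ 2 * (x - 1) * Real.log (Real.Gamma (3 / 2)) := by
      have := hconv.2 (show (1 : ℝ) ∈ Set.Ioi 0 by norm_num) (show (3 / 2 : ℝ) ∈ Set.Ioi 0 by norm_num) 
        (show 0 ≤ 3 - 2 * x by linarith) (show 0 ≤ 2 * (x - 1) by linarith) (by ring)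
      simp only [smul_eq_mul, Function.comp_apply, Real.Gamma_one, Real.log_one, mul_zero,
        zero_add] at this
      rwa [show (3 - 2 * x) * 1 + 2 * (x - 1) * (3 / 2) = x by ring] at this
    -- Here `0.04 = 0.54 - 1/2` comes from the bound on `log π / 2`, and `0.22 = 2 * 0.11` is the
    -- slope of the chord bound.
    have h5 : -0.04 - 0.22 * (x - 1) ≤ (x - 1) * (x - 2) / (x + 1) := by
      rw [le_div_iff₀ (by linarith)]; nlinarith [sq_nonneg (x - 5 / 4)]
    nlinarith
  · have hc : Real.log (Real.Gamma x) ≤ 2 * (2 - x) * Real.log (Real.Gamma (3 / 2)) := by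
      have := hconv.2 (show (2 : ℝ) ∈ Set.Ioi 0 by norm_num) (show (3 / 2 : ℝ) ∈ Set.Ioi 0 by norm_num) 
        (show 0 ≤ 2 * x - 3 by linarith) (show 0 ≤ 2 * (2 - x) by linarith) (by ring)
      simp only [smul_eq_mul, Function.comp_apply, Real.Gamma_two, Real.log_one, mul_zero,
        zero_add] at this
      rwa [show (2 * x - 3) * 2 + 2 * (2 - x) * (3 / 2) = x by ring] at this
    have h5 : -0.04 - 0.22 * (2 - x) ≤ (x - 1) * (x - 2) / (x + 1) := by
      rw [le_div_iff₀ (by linarith)]; nlinarith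
    nlinarith

/-- Passing from `y` to `y + 1` adds `log y` on the left and at least as much on the right, because
`(y + 1/2) log (1 + 1/y) ≥ 1`. The constant is chosen so that `x = (a + 1) / 2` gives exactly
`gaussianAbsMoment_lt`. -/
theorem Real.log_Gamma_lt {x : ℝ} (h1 : 1 ≤ x) :
    Real.log (Real.Gamma x) < Real.log Real.pi / 2 + (x - 1 / 2) * (Real.log x - 1) := by
  have step : ∀ (n : ℕ) (x : ℝ), 1 ≤ x → x ≤ n + 2 →
      Real.log (Real.Gamma x) < Real.log Real.pi / 2 + (x - 1 / 2) * (Real.log x - 1) := by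
    intro n
    induction n with
    | zero => exact fun x h1 h2 => Real.log_Gamma_lt_of_mem_Icc h1 (by simpa using h2)
    | succ n ih =>
      intro x h1 h2
      rcases le_total x 2 with h | h
      · exact Real.log_Gamma_lt_of_mem_Icc h1 h
      obtain ⟨y, rfl⟩ : ∃ y, x = y + 1 := ⟨x - 1, by ring⟩
      have hy1 : 1 ≤ y := by linarith
      have hy : 0 < y := by linarith
      have h := ih y hy1 (by push_cast at h2; linarith)
      rw [Real.Gamma_add_one hy.ne', Real.log_mul hy.ne' (Real.Gamma_pos_of_pos hy).ne']
      have hl := Real.le_log_one_add_of_nonneg (x := 1 / y) (by positivity)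
      have e1 : 1 + 1 / y = (y + 1) / y := by field_simp
      have e2 : 2 * (1 / y) / (1 / y + 2) = 1 / (y + 1 / 2) := by field_simp; ring
      rw [e1, e2, Real.log_div (by linarith) hy.ne', div_le_iff₀ (by linarith)] at hl
      nlinarith
  exact step ⌈x⌉₊ x h1 (by linarith [Nat.le_ceil x])

/-! ### Gaussian moments -/

/-- The `a`-th absolute moment of the standard normal distribution. -/
noncomputable def gaussianAbsMoment (a : ℝ) : ℝ :=
  (2 : ℝ) ^ (a / 2) / √Real.pi * Real.Gamma ((a + 1) / 2)

theorem gaussianAbsMoment_pos {a : ℝ} (ha : -1 < a) : 0 < gaussianAbsMoment a := by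
  have := Real.Gamma_pos_of_pos (s := (a + 1) / 2) (by linarith)
  unfold gaussianAbsMoment
  positivity

theorem gaussianAbsMoment_rpow_one_div {a : ℝ} (ha : 0 < a) :
    gaussianAbsMoment a ^ (1 / a) =
      √2 * Real.pi ^ (-(1 / (2 * a))) * Real.Gamma ((a + 1) / 2) ^ (1 / a) := by
  have := Real.Gamma_pos_of_pos (s := (a + 1) / 2) (by linarith)
  rw [gaussianAbsMoment, Real.mul_rpow (by positivity) this.le,
    Real.div_rpow (by positivity) (by positivity), ← Real.rpow_mul (by norm_num),
    Real.sqrt_eq_rpow, Real.sqrt_eq_rpow, ← Real.rpow_mul Real.pi_pos.le, Real.rpow_neg Real.pi_pos.le]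
  rw [div_eq_mul_inv, show a / 2 * (1 / a) = 1 / 2 by field_simp,
    show 1 / 2 * (1 / a) = 1 / (2 * a) by field_simp]

theorem gaussianAbsMoment_lt {a : ℝ} (ha : 1 ≤ a) :
    gaussianAbsMoment a < √((a + 1) / Real.exp 1) ^ a := by
  have hG := Real.Gamma_pos_of_pos (s := (a + 1) / 2) (by linarith)
  have h := Real.log_Gamma_lt (x := (a + 1) / 2) (by linarith)
  rw [← Real.log_lt_log_iff (gaussianAbsMoment_pos (by linarith)) (by positivity),
    gaussianAbsMoment, Real.log_mul (by positivity) hG.ne', Real.log_div (by positivity)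
    (by positivity), Real.log_rpow (by norm_num), Real.log_rpow (by positivity),
    Real.log_sqrt (by positivity), Real.log_sqrt (by positivity),
    Real.log_div (by positivity) (by positivity), Real.log_exp]
  rw [Real.log_div (by positivity) (by norm_num)] at h
  linarith

theorem gaussianAbsMoment_rpow_one_div_lt {a : ℝ} (ha : 1 ≤ a) :
    gaussianAbsMoment a ^ (1 / a) < √((a + 1) / Real.exp 1) := by
  have ha0 : 0 < a := by linarith
  have h := Real.rpow_lt_rpow (gaussianAbsMoment_pos (by linarith)).le (gaussianAbsMoment_lt ha)
    (one_div_pos.2 ha0)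
  rwa [← Real.rpow_mul (by positivity), mul_one_div_cancel ha0.ne', Real.rpow_one] at h

/-! ### Moments of a coordinate on the unit sphere -/

section SphereMoment

variable {V : Type*} [NormedAddCommGroup V] [InnerProductSpace ℝ V] [FiniteDimensional ℝ V]
  [MeasurableSpace V] [BorelSpace V]

theorem lintegral_eq_lintegral_toSphere [Nontrivial V] {f : V → ℝ≥0∞} (hf : Measurable f) :
    ∫⁻ x, f x = ∫⁻ u : Metric.sphere (0 : V) 1, (∫⁻ r in Set.Ioi (0 : ℝ),
      ENNReal.ofReal (r ^ (Module.finrank ℝ V - 1)) * f (r • (u : V)))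
        ∂(volume : Measure V).toSphere := by
  have hF : Measurable (fun q : Metric.sphere (0 : V) 1 × Set.Ioi (0 : ℝ) =>
      f ((q.2 : ℝ) • (q.1 : V))) :=
    hf.comp ((measurable_subtype_coe.comp measurable_snd).smul
      (measurable_subtype_coe.comp measurable_fst))
  calc ∫⁻ x, f x = ∫⁻ x : ({0}ᶜ : Set V), f x ∂((volume : Measure V).comap (↑)) := by
        rw [lintegral_subtype_comap (measurableSet_singleton _).compl, restrict_compl_singleton]
    _ = ∫⁻ x : ({0}ᶜ : Set V), (fun q : Metric.sphere (0 : V) 1 × Set.Ioi (0 : ℝ) =>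
          f ((q.2 : ℝ) • (q.1 : V))) (homeomorphUnitSphereProd V x)
          ∂((volume : Measure V).comap (↑)) := by
        refine lintegral_congr fun x => ?_
        have hx : ‖(x : V)‖ ≠ 0 := norm_ne_zero_iff.2 x.2
        simp [smul_smul, hx]
    _ = ∫⁻ q : Metric.sphere (0 : V) 1 × Set.Ioi (0 : ℝ), f ((q.2 : ℝ) • (q.1 : V))
          ∂((volume : Measure V).toSphere.prod
            (Measure.volumeIoiPow (Module.finrank ℝ V - 1))) :=
        (volume : Measure V).measurePreserving_homeomorphUnitSphereProd.lintegral_comp hF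
    _ = _ := by
        rw [lintegral_prod _ hF.aemeasurable]
        refine lintegral_congr fun u => ?_
        have h1 : Measurable (fun r : Set.Ioi (0 : ℝ) =>
            ENNReal.ofReal ((r : ℝ) ^ (Module.finrank ℝ V - 1))) :=
          (measurable_subtype_coe.pow_const _).ennreal_ofReal
        have h2 : Measurable (fun r : Set.Ioi (0 : ℝ) => f ((r : ℝ) • (u : V))) :=
          hf.comp (measurable_subtype_coe.smul_const _)
        rw [Measure.volumeIoiPow, lintegral_withDensity_eq_lintegral_mul _ h1 h2]
        exact lintegral_subtype_comap measurableSet_Ioi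
          (fun r : ℝ => ENNReal.ofReal (r ^ (Module.finrank ℝ V - 1)) * f (r • (u : V)))

theorem lintegral_Ioi_pow_mul_rpow_mul_exp {n : ℕ} (hn : 0 < n) {a : ℝ} (ha : -1 < a) :
    ∫⁻ r in Set.Ioi (0 : ℝ), ENNReal.ofReal (r ^ (n - 1)) *
      (‖r‖ₑ ^ a * ENNReal.ofReal (Real.exp (-r ^ 2))) =
      ENNReal.ofReal (1 / 2 * Real.Gamma ((n + a) / 2)) := by
  have hn1 : (1 : ℝ) ≤ n := by exact_mod_cast hn
  have hq : (-1 : ℝ) < n - 1 + a := by linarith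
  have h1 := integral_rpow_mul_exp_neg_rpow (p := 2) (q := n - 1 + a) (by norm_num) hq
  have h2 := integrableOn_rpow_mul_exp_neg_rpow (p := 2) (s := n - 1 + a) hq (by norm_num)
  rw [show (n - 1 + a + 1 : ℝ) = n + a by ring] at h1
  rw [← h1, ofReal_integral_eq_lintegral_ofReal h2]
  · refine setLIntegral_congr_fun measurableSet_Ioi fun r hr => ?_
    have hr : 0 < r := hr
    rw [Real.enorm_eq_ofReal hr.le, ENNReal.ofReal_rpow_of_pos hr,
      ← ENNReal.ofReal_mul (by positivity), ← ENNReal.ofReal_mul (by positivity),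
      Real.rpow_add hr, ← mul_assoc]
    congr 3
    · rw [← Nat.cast_pred hn, Real.rpow_natCast]
    · norm_num
  · filter_upwards [ae_restrict_mem measurableSet_Ioi] with r hr
    have hr : 0 < r := hr
    positivity

/-- The integral of `|⟪e, x⟫| ^ a exp(-|x|²)` in polar coordinates. -/
theorem lintegral_inner_rpow_mul_exp_eq_toSphere [Nontrivial V] (e : V) {a : ℝ} (ha : -1 < a) :
    ∫⁻ x : V, ‖inner ℝ e x‖ₑ ^ a * ENNReal.ofReal (Real.exp (-‖x‖ ^ 2)) =
      (∫⁻ u : Metric.sphere (0 : V) 1, ‖inner ℝ e (u : V)‖ₑ ^ a ∂(volume : Measure V).toSphere) *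
        ENNReal.ofReal (1 / 2 * Real.Gamma ((Module.finrank ℝ V + a) / 2)) := by
  have hm : Measurable (fun x : V => ‖inner ℝ e x‖ₑ ^ a * ENNReal.ofReal (Real.exp (-‖x‖ ^ 2))) := by
    fun_prop
  rw [lintegral_eq_lintegral_toSphere hm, ← lintegral_mul_const _ (by fun_prop)]
  refine lintegral_congr fun u => ?_
  rw [← lintegral_Ioi_pow_mul_rpow_mul_exp Module.finrank_pos ha, ← lintegral_const_mul _ (by fun_prop)]
  refine lintegral_congr fun r => ?_
  have hu : ‖(u : V)‖ = 1 := by simp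
  rw [inner_smul_right, enorm_mul, ENNReal.mul_rpow_of_ne_top enorm_ne_top enorm_ne_top,
    norm_smul, hu, mul_one, Real.norm_eq_abs, sq_abs]
  ring

theorem lintegral_rpow_mul_exp {a : ℝ} (ha : -1 < a) :
    ∫⁻ t : ℝ, ‖t‖ₑ ^ a * ENNReal.ofReal (Real.exp (-t ^ 2)) =
      ENNReal.ofReal (Real.Gamma ((a + 1) / 2)) := by
  -- This is the polar formula in dimension one: the sphere is `{1, -1}`, of total mass `2`, which
  -- cancels the factor `1 / 2`.
  have h := lintegral_inner_rpow_mul_exp_eq_toSphere (V := ℝ) (1 : ℝ) ha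
  have h1 : ∀ u : Metric.sphere (0 : ℝ) 1, ‖inner ℝ (1 : ℝ) (u : ℝ)‖ₑ ^ a = 1 := by
    intro u
    have : ‖(u : ℝ)‖ = 1 := by simp
    have h2 : ‖(u : ℝ)‖ₑ = 1 := by rw [← ofReal_norm, this, ENNReal.ofReal_one]
    simp [h2]
  simp only [h1] at h
  have h2 : ∀ t : ℝ, inner ℝ (1 : ℝ) t = t := by intro t; simp
  simp only [h2, Real.norm_eq_abs, sq_abs] at h
  rw [h]
  simp only [lintegral_const, one_mul, Measure.toSphere_apply_univ, Module.finrank_self,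
    Real.volume_ball, Nat.cast_one]
  rw [← ENNReal.ofReal_mul (by norm_num)]
  congr 1
  rw [add_comm a 1]; ring

omit [MeasurableSpace V] [BorelSpace V] in
theorem exists_orthonormalBasis_apply_zero_eq {n : ℕ} (hn : Module.finrank ℝ V = n + 1) {e : V}
    (he : ‖e‖ = 1) : ∃ b : OrthonormalBasis (Fin (n + 1)) ℝ V, b 0 = e := by
  have ho : Orthonormal ℝ (({0} : Set (Fin (n + 1))).domRestrict fun _ => e) := by
    refine ⟨fun _ => he, fun i j hij => ?_⟩
    exact absurd (Subsingleton.elim i j) hij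
  obtain ⟨b, hb⟩ := ho.exists_orthonormalBasis_extension_of_card_eq (by simpa using hn)
  exact ⟨b, hb 0 rfl⟩

/-- The integral of `|⟪e, x⟫| ^ a exp(-|x|²)` by Fubini, up to a factor independent of `a`. -/
theorem exists_lintegral_inner_rpow_mul_exp_eq [Nontrivial V] {e : V} (he : ‖e‖ = 1) :
    ∃ H : ℝ≥0∞, ∀ a : ℝ, -1 < a →
      ∫⁻ x : V, ‖inner ℝ e x‖ₑ ^ a * ENNReal.ofReal (Real.exp (-‖x‖ ^ 2)) =
        ENNReal.ofReal (Real.Gamma ((a + 1) / 2)) * H := by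
  obtain ⟨n, hn⟩ : ∃ n, Module.finrank ℝ V = n + 1 :=
    ⟨_, (Nat.sub_add_cancel (Module.finrank_pos (R := ℝ) (M := V))).symm⟩
  obtain ⟨b, hb⟩ := exists_orthonormalBasis_apply_zero_eq hn he
  refine ⟨∫⁻ y : Fin n → ℝ, ENNReal.ofReal (Real.exp (-∑ i, y i ^ 2)), fun a ha => ?_⟩
  rw [← lintegral_rpow_mul_exp ha]
  have h1 : ∀ x : V, ‖inner ℝ e x‖ₑ ^ a * ENNReal.ofReal (Real.exp (-‖x‖ ^ 2)) =
      (fun y : EuclideanSpace ℝ (Fin (n + 1)) => ‖y 0‖ₑ ^ a *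
        ENNReal.ofReal (Real.exp (-∑ i, y i ^ 2))) (b.repr x) := by
    intro x
    dsimp only
    rw [b.repr_apply_apply, hb, ← b.repr.norm_map x, EuclideanSpace.norm_sq_eq]
    simp
  have hm : Measurable (fun y : EuclideanSpace ℝ (Fin (n + 1)) => ‖y 0‖ₑ ^ a *
        ENNReal.ofReal (Real.exp (-∑ i, y i ^ 2))) := by fun_prop
  have hm2 : Measurable (fun y : Fin (n + 1) → ℝ => ‖y 0‖ₑ ^ a *
        ENNReal.ofReal (Real.exp (-∑ i, y i ^ 2))) := by fun_prop
  simp_rw [h1]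
  rw [b.measurePreserving_repr.lintegral_comp hm]
  have h2 := (EuclideanSpace.volume_preserving_symm_measurableEquiv_toLp
    (Fin (n + 1))).lintegral_comp hm2
  have h3 := (volume_preserving_piFinSuccAbove (fun _ : Fin (n + 1) => ℝ) 0).symm.lintegral_comp hm2
  refine (Eq.trans ?_ h2).trans (h3.symm.trans ?_)
  · rfl
  · rw [Measure.volume_eq_prod, ← lintegral_prod_mul (Measurable.aemeasurable (by fun_prop)) (Measurable.aemeasurable (by fun_prop))]
    refine lintegral_congr fun q => ?_
    simp only [MeasurableEquiv.piFinSuccAbove_symm_apply, Fin.insertNthEquiv_apply,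
      Fin.sum_univ_succ, Fin.insertNth_zero', Fin.cons_zero, Fin.cons_succ]
    rw [neg_add, Real.exp_add, ENNReal.ofReal_mul (Real.exp_nonneg _), mul_assoc]

/-- A Gaussian integral is computed both in polar coordinates and by Fubini. The case `a = 0`
determines the unknown factor `H` in terms of the area of the sphere, and the area cancels in the
average. -/
theorem laverage_toSphere_inner_rpow [Nontrivial V] {e : V} (he : ‖e‖ = 1) {a : ℝ} (ha : -1 < a) :
    ⨍⁻ u : Metric.sphere (0 : V) 1, ‖inner ℝ e (u : V)‖ₑ ^ a ∂(volume : Measure V).toSphere =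
      ENNReal.ofReal (Real.Gamma ((a + 1) / 2) * Real.Gamma (Module.finrank ℝ V / 2) /
        (√Real.pi * Real.Gamma ((Module.finrank ℝ V + a) / 2))) := by
  obtain ⟨H, hH⟩ := exists_lintegral_inner_rpow_mul_exp_eq he
  have hn : (1 : ℝ) ≤ Module.finrank ℝ V := by exact_mod_cast Module.finrank_pos (R := ℝ) (M := V)
  have g1 := Real.Gamma_pos_of_pos (s := (a + 1) / 2) (by linarith)
  have g2 := Real.Gamma_pos_of_pos (s := (Module.finrank ℝ V : ℝ) / 2) (by linarith)
  have g3 := Real.Gamma_pos_of_pos (s := ((Module.finrank ℝ V : ℝ) + a) / 2) (by linarith)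
  have ea := (lintegral_inner_rpow_mul_exp_eq_toSphere e ha).symm.trans (hH a ha)
  have e0 := (lintegral_inner_rpow_mul_exp_eq_toSphere e (by norm_num : (-1 : ℝ) < 0)).symm.trans
    (hH 0 (by norm_num))
  simp only [ENNReal.rpow_zero, lintegral_const, one_mul, add_zero, zero_add,
    Real.Gamma_one_half_eq] at e0
  rw [laverage_eq]
  set S := (volume : Measure V).toSphere Set.univ with hS
  set J := ∫⁻ u : Metric.sphere (0 : V) 1, ‖inner ℝ e (u : V)‖ₑ ^ a ∂(volume : Measure V).toSphere
  have hS0 : S ≠ 0 := by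
    rw [hS, Ne, Measure.measure_univ_eq_zero]; exact Measure.toSphere_ne_zero _
  have hSt : S ≠ ⊤ := measure_ne_top _ _
  have hp := Real.sqrt_pos.2 Real.pi_pos
  have hHeq : H = S * ENNReal.ofReal (1 / 2 * Real.Gamma ((Module.finrank ℝ V : ℝ) / 2)) /
      ENNReal.ofReal √Real.pi := by
    rw [e0, mul_comm, ENNReal.mul_div_cancel_right (by simpa using hp) ENNReal.ofReal_ne_top]
  have hJ : J = ENNReal.ofReal (Real.Gamma ((a + 1) / 2)) * H /
      ENNReal.ofReal (1 / 2 * Real.Gamma ((Module.finrank ℝ V + a) / 2)) := by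
    rw [← ea, ENNReal.mul_div_cancel_right _ ENNReal.ofReal_ne_top]
    rw [Ne, ENNReal.ofReal_eq_zero, not_le]; positivity
  rw [hJ, hHeq]
  clear_value S J
  lift S to NNReal using hSt
  have hS1 : (S : ℝ) ≠ 0 := by exact_mod_cast hS0
  rw [← ENNReal.ofReal_coe_nnreal (p := S)]
  rw [← ENNReal.ofReal_mul (by positivity), ← ENNReal.ofReal_div_of_pos hp,
    ← ENNReal.ofReal_mul (by positivity), ← ENNReal.ofReal_div_of_pos (by positivity),
    ← ENNReal.ofReal_div_of_pos (by positivity)]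
  congr 1
  field_simp

end SphereMoment

/-! ### Differentiation under an integral over a compact manifold -/

section ParametricIntegral

variable {k : ℕ} {G : Type*} [TopologicalSpace G] [ChartedSpace (EuclideanSpace ℝ (Fin k)) G]
  [IsManifold (𝓡 k) ∞ G]
  {W V : Type*} [NormedAddCommGroup W] [NormedSpace ℝ W]
  [NormedAddCommGroup V] [NormedSpace ℝ V]

theorem continuousOn_fderiv_of_contMDiffOn_prod {h : G → W → V} {U : Set W} (hU : IsOpen U)
    (hh : ContMDiffOn ((𝓡 k).prod 𝓘(ℝ, W)) 𝓘(ℝ, V) ∞ (Function.uncurry h) (Set.univ ×ˢ U)) :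
    ContinuousOn (fun q : G × W => fderiv ℝ (h q.1) q.2) (Set.univ ×ˢ U) := by
  intro q hq
  have hO : IsOpen (Set.univ ×ˢ U : Set (G × W)) := isOpen_univ.prod hU
  have h1 : ContMDiffAt ((𝓡 k).prod 𝓘(ℝ, W)) 𝓘(ℝ, V) ∞ (Function.uncurry h) q :=
    hh.contMDiffAt (hO.mem_nhds hq)
  have h2 : ContMDiffAt (((𝓡 k).prod 𝓘(ℝ, W)).prod 𝓘(ℝ, W)) 𝓘(ℝ, V) ∞
      (Function.uncurry fun (r : G × W) (y : W) => h r.1 y) (q, q.2) := by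
    have h3 : ContMDiffAt (((𝓡 k).prod 𝓘(ℝ, W)).prod 𝓘(ℝ, W)) ((𝓡 k).prod 𝓘(ℝ, W)) ∞
        (fun r : (G × W) × W => (r.1.1, r.2)) (q, q.2) :=
      (contMDiffAt_fst.fst).prodMk contMDiffAt_snd
    exact ContMDiffAt.comp (q, q.2) (g := Function.uncurry h) h1 h3
  -- Only continuity of the partial derivative is needed, hence `m := 0`. Tangent coordinates of a
  -- vector space are trivial, so this is continuity of `fderiv` itself.
  have h4 := ContMDiffAt.mfderiv (m := 0) (n := ∞) (fun (r : G × W) (y : W) => h r.1 y)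
    (fun r : G × W => r.2) h2 contMDiffAt_snd (by simp)
  have h5 := h4.continuousAt
  simp only [inTangentCoordinates_model_space, mfderiv_eq_fderiv] at h5
  exact h5.continuousWithinAt

variable [CompactSpace G] [MeasurableSpace G] [BorelSpace G] [FiniteDimensional ℝ W]
  [FiniteDimensional ℝ V]

/-- Compactness of `G` bounds the derivative uniformly over the product of `G` with a compact
neighbourhood of each point. Dominated convergence then gives both the derivative and its
continuity. -/
theorem contDiffOn_integral_clm_apply {ν : Measure G} [IsFiniteMeasure ν] {ρ : G → V →L[ℝ] V}
    (hρ : Continuous ρ) {h : G → W → V} {U : Set W} (hU : IsOpen U)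
    (hh : ContMDiffOn ((𝓡 k).prod 𝓘(ℝ, W)) 𝓘(ℝ, V) ∞ (Function.uncurry h) (Set.univ ×ˢ U)) :
    ContDiffOn ℝ 1 (fun x => ∫ g, ρ g (h g x) ∂ν) U := by
  have hO : IsOpen (Set.univ ×ˢ U : Set (G × W)) := isOpen_univ.prod hU
  have hcd := continuousOn_fderiv_of_contMDiffOn_prod hU hh
  have hc0 : ContinuousOn (Function.uncurry h) (Set.univ ×ˢ U) := hh.continuousOn
  have hF' : ContinuousOn (fun q : G × W => (ρ q.1).comp (fderiv ℝ (h q.1) q.2))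
      (Set.univ ×ˢ U) := (hρ.comp continuous_fst).continuousOn.clm_comp hcd
  have hslice : ∀ x ∈ U, Continuous fun g : G => (ρ g).comp (fderiv ℝ (h g) x) := by
    intro x hx
    have hg : Continuous fun g : G => (g, x) := by fun_prop
    exact hF'.comp_continuous hg fun g => ⟨trivial, hx⟩
  have hslice0 : ∀ x ∈ U, Continuous fun g : G => ρ g (h g x) := by
    intro x hx
    have hg : Continuous fun g : G => (g, x) := by fun_prop
    exact hρ.clm_apply (hc0.comp_continuous hg fun g => ⟨trivial, hx⟩)
  have hdiff : ∀ g : G, ∀ x ∈ U, HasFDerivAt (fun y => ρ g (h g y))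
      ((ρ g).comp (fderiv ℝ (h g) x)) x := by
    intro g x hx
    have h1 : ContMDiffAt ((𝓡 k).prod 𝓘(ℝ, W)) 𝓘(ℝ, V) ∞ (Function.uncurry h) (g, x) :=
      hh.contMDiffAt (hO.mem_nhds ⟨trivial, hx⟩)
    have h2 : ContMDiffAt 𝓘(ℝ, W) ((𝓡 k).prod 𝓘(ℝ, W)) ∞ (fun y : W => (g, y)) x :=
      contMDiffAt_const.prodMk contMDiffAt_id
    have h3 : ContMDiffAt 𝓘(ℝ, W) 𝓘(ℝ, V) ∞ (h g) x := ContMDiffAt.comp x (g := Function.uncurry h) h1 h2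
    have h4 : DifferentiableAt ℝ (h g) x :=
      (contMDiffAt_iff_contDiffAt.1 h3).differentiableAt (by simp)
    exact (ρ g).hasFDerivAt.comp x h4.hasFDerivAt
  have hbound : ∀ x ∈ U, ∃ C : ℝ, ∃ s ∈ 𝓝 x, s ⊆ U ∧
      ∀ g : G, ∀ y ∈ s, ‖(ρ g).comp (fderiv ℝ (h g) y)‖ ≤ C := by
    intro x hx
    obtain ⟨s, hs, hsU, hsc⟩ := local_compact_nhds (hU.mem_nhds hx)
    have hcomp : IsCompact (Set.univ ×ˢ s : Set (G × W)) := isCompact_univ.prod hsc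
    obtain ⟨C, hC⟩ := hcomp.exists_bound_of_continuousOn
      (hF'.mono (Set.prod_mono_right hsU))
    exact ⟨C, s, hs, hsU, fun g y hy => hC (g, y) ⟨trivial, hy⟩⟩
  have hderiv : ∀ x ∈ U, HasFDerivAt (fun x => ∫ g, ρ g (h g x) ∂ν)
      (∫ g, (ρ g).comp (fderiv ℝ (h g) x) ∂ν) x := by
    intro x hx
    obtain ⟨C, s, hs, hsU, hC⟩ := hbound x hx
    refine hasFDerivAt_integral_of_dominated_of_fderiv_le
      (F' := fun x g => (ρ g).comp (fderiv ℝ (h g) x)) (bound := fun _ => C) hs ?_ ?_ ?_ ?_ ?_ ?_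
    · filter_upwards [hU.mem_nhds hx] with y hy
      exact (hslice0 y hy).aestronglyMeasurable
    · exact (hslice0 x hx).integrable_of_hasCompactSupport (HasCompactSupport.of_compactSpace _)
    · exact (hslice x hx).aestronglyMeasurable
    · exact .of_forall hC
    · exact integrable_const C
    · exact .of_forall fun g y hy => hdiff g y (hsU hy)
  have hcont : ContinuousOn (fun x => ∫ g, (ρ g).comp (fderiv ℝ (h g) x) ∂ν) U := by
    intro x hx
    obtain ⟨C, s, hs, hsU, hC⟩ := hbound x hx
    refine ContinuousAt.continuousWithinAt ?_
    refine continuousAt_of_dominated (bound := fun _ => C) ?_ ?_ (integrable_const C) ?_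
    · filter_upwards [hs] with y hy
      exact (hslice y (hsU hy)).aestronglyMeasurable
    · filter_upwards [hs] with y hy
      exact .of_forall fun g => hC g y hy
    · refine .of_forall fun g => ?_
      have hg : ContinuousAt (fun y : W => (g, y)) x := by fun_prop
      exact ContinuousAt.comp (f := fun y : W => (g, y))
        (g := fun q : G × W => (ρ q.1).comp (fderiv ℝ (h q.1) q.2))
        (hF'.continuousAt (hO.mem_nhds ⟨trivial, hx⟩)) hg
  rw [show (1 : WithTop ℕ∞) = 0 + 1 by simp, contDiffOn_succ_iff_fderiv_of_isOpen hU]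
  refine ⟨fun x hx => (hderiv x hx).differentiableAt.differentiableWithinAt, by simp, ?_⟩
  rw [contDiffOn_zero]
  exact hcont.congr fun x hx => (hderiv x hx).fderiv

end ParametricIntegral

/-! ### Regularity of equivariant maps -/

section EquivariantMaps

variable {m : ℕ} {M : Type*} [TopologicalSpace M] [ChartedSpace (EuclideanSpace ℝ (Fin m)) M]
  [IsManifold (𝓡 m) ∞ M]
  {V : Type*} [NormedAddCommGroup V] [NormedSpace ℝ V] [FiniteDimensional ℝ V]

theorem contMDiff_integral_clm_smul
    {k : ℕ} {G : Type*} [Group G] [TopologicalSpace G] [ChartedSpace (EuclideanSpace ℝ (Fin k)) G]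
    [LieGroup (𝓡 k) ∞ G] [CompactSpace G] [MulAction G M] [ContMDiffSMul (𝓡 k) (𝓡 m) ∞ G M]
    [MeasurableSpace G] [BorelSpace G]
    {ν : Measure G} [IsFiniteMeasure ν] {ρ : G → V →L[ℝ] V}
    (hρ : Continuous ρ) {η : M → V} (hη : ContMDiff (𝓡 m) 𝓘(ℝ, V) ∞ η) :
    ContMDiff (𝓡 m) 𝓘(ℝ, V) 1 (fun p => ∫ g, ρ g (η (g⁻¹ • p)) ∂ν) := by
  have : IsManifold (𝓡 k) ∞ G := inferInstance
  intro p₀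
  set χ := extChartAt (𝓡 m) p₀
  have hopen : IsOpen χ.target := isOpen_extChartAt_target p₀
  have hsm : ContMDiffOn ((𝓡 k).prod 𝓘(ℝ, EuclideanSpace ℝ (Fin m))) 𝓘(ℝ, V) ∞
      (Function.uncurry fun (g : G) (x : EuclideanSpace ℝ (Fin m)) => η (g⁻¹ • χ.symm x))
      (Set.univ ×ˢ χ.target) := by
    have h1 : ContMDiffOn ((𝓡 k).prod 𝓘(ℝ, EuclideanSpace ℝ (Fin m))) (𝓡 m) ∞
        (fun q : G × EuclideanSpace ℝ (Fin m) => χ.symm q.2) (Set.univ ×ˢ χ.target) :=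
      (contMDiffOn_extChartAt_symm p₀).comp contMDiffOn_snd fun q hq => hq.2
    have h2 : ContMDiffOn ((𝓡 k).prod 𝓘(ℝ, EuclideanSpace ℝ (Fin m))) (𝓡 k) ∞
        (fun q : G × EuclideanSpace ℝ (Fin m) => q.1⁻¹) (Set.univ ×ˢ χ.target) :=
      (contMDiff_fst.inv).contMDiffOn
    exact hη.comp_contMDiffOn (h2.smul h1)
  have hcd := contDiffOn_integral_clm_apply (ν := ν) hρ hopen hsm
  have h3 : ContMDiffAt (𝓡 m) 𝓘(ℝ, V) 1
      ((fun x => ∫ g, ρ g (η (g⁻¹ • χ.symm x)) ∂ν) ∘ χ) p₀ := by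
    refine ContMDiffAt.comp p₀ ?_ contMDiffAt_extChartAt
    exact (hcd.contDiffAt (hopen.mem_nhds (mem_extChartAt_target p₀))).contMDiffAt
  refine h3.congr_of_eventuallyEq ?_
  filter_upwards [extChartAt_source_mem_nhds (I := 𝓡 m) p₀] with p hp
  simp only [Function.comp_apply, χ, (extChartAt (𝓡 m) p₀).left_inv hp]

/-- A map from a homogeneous space of a compact Lie group to a finite dimensional normed space is
`C¹` as soon as it is continuous and intertwines the action with a continuous isometric
representation. -/
theorem contMDiff_of_equivariant
    {k : ℕ} {G : Type*} [Group G] [TopologicalSpace G] [ChartedSpace (EuclideanSpace ℝ (Fin k)) G]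
    [LieGroup (𝓡 k) ∞ G] [CompactSpace G] [MulAction G M] [ContMDiffSMul (𝓡 k) (𝓡 m) ∞ G M]
    [T2Space M] [CompactSpace M] [MulAction.IsPretransitive G M]
    {ρ : G →* (V →L[ℝ] V)} (hρ : Continuous ρ) (hnorm : ∀ g v, ‖ρ g v‖ = ‖v‖) {ψ : M → V}
    (hψ : Continuous ψ) (hequiv : ∀ (g : G) p, ψ (g • p) = ρ g (ψ p)) :
    ContMDiff (𝓡 m) 𝓘(ℝ, V) 1 ψ := by
  rcases isEmpty_or_nonempty M with hM | ⟨⟨o⟩⟩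
  · exact fun p => (hM.false p).elim
  borelize G
  have : IsTopologicalGroup G := topologicalGroup_of_lieGroup (𝓡 k) ∞
  let K₀ : TopologicalSpace.PositiveCompacts G := ⊤
  let ν : Measure G := Measure.haarMeasure K₀
  have : IsProbabilityMeasure ν := ⟨by
    simpa [K₀] using Measure.haarMeasure_self (K₀ := K₀)⟩
  -- `S` consists of the values at `o` of `C¹` equivariant maps. It is closed, being finite
  -- dimensional, so it suffices to approximate `ψ o` by elements of `S`; an equivariant map is
  -- determined by its value at `o`.
  let S : Submodule ℝ V :=
    { carrier := {v | ∃ θ : M → V, ContMDiff (𝓡 m) 𝓘(ℝ, V) 1 θ ∧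
        (∀ (g : G) p, θ (g • p) = ρ g (θ p)) ∧ θ o = v}
      add_mem' := by
        rintro _ _ ⟨θ, h1, h2, rfl⟩ ⟨θ', h1', h2', rfl⟩
        exact ⟨fun p => θ p + θ' p, h1.add h1', fun g p => by simp only [h2, h2', map_add], rfl⟩
      zero_mem' := ⟨fun _ => 0, contMDiff_const, fun g p => by simp, rfl⟩
      smul_mem' := by
        rintro c _ ⟨θ, h1, h2, rfl⟩
        exact ⟨fun p => c • θ p, (c • ContinuousLinearMap.id ℝ V).contMDiff.comp h1, fun g p => by simp only [h2, map_smul], rfl⟩ }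
  have hmem : ψ o ∈ S := by
    have hcl : IsClosed (S : Set V) := S.closed_of_finiteDimensional
    rw [← SetLike.mem_coe, ← hcl.closure_eq, Metric.mem_closure_iff]
    intro ε hε
    obtain ⟨η, hη⟩ := exists_contMDiffMap_forall_mem_convex_of_local_const (n := (⊤ : ℕ∞)) (𝓡 m)
      (t := fun p => Metric.ball (ψ p) (ε / 2)) (fun p => convex_ball _ _) (fun p =>
        ⟨ψ p, by
          have := hψ.continuousAt (x := p) (Metric.ball_mem_nhds (ψ p) (half_pos hε))
          filter_upwards [this] with q hq
          rw [Metric.mem_ball, dist_comm]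
          exact hq⟩)
    have hint : ∀ p, Continuous fun g : G => ρ g (η (g⁻¹ • p)) := by
      intro p
      have : ContinuousSMul G M := ContMDiffSMul.continuousSMul (I := 𝓡 k) (I' := 𝓡 m) ∞
      have : Continuous fun g : G => η (g⁻¹ • p) :=
        η.contMDiff.continuous.comp (continuous_inv.smul continuous_const)
      exact hρ.clm_apply this
    -- Haar averaging makes the smooth approximation `η` equivariant. It fixes `ψ` and does not
    -- increase the uniform distance, so the error stays at most `ε / 2`.
    refine ⟨∫ g, ρ g (η (g⁻¹ • o)) ∂ν,
      ⟨fun p => ∫ g, ρ g (η (g⁻¹ • p)) ∂ν, contMDiff_integral_clm_smul (k := k) hρ η.contMDiff, ?_, rfl⟩, ?_⟩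
    · intro x p
      dsimp only
      rw [← integral_mul_left_eq_self (fun g => ρ g (η (g⁻¹ • x • p))) x]
      simp only [mul_inv_rev, map_mul, mul_smul, inv_smul_smul]
      exact (ρ x).integral_comp_comm
        ((hint p).integrable_of_hasCompactSupport (HasCompactSupport.of_compactSpace _))
    · have h1 : ψ o = ∫ _ : G, ψ o ∂ν := by simp
      rw [dist_eq_norm, h1, ← integral_sub (integrable_const _)
        ((hint o).integrable_of_hasCompactSupport (HasCompactSupport.of_compactSpace _))]
      refine (norm_integral_le_of_norm_le_const (C := ε / 2) (.of_forall fun g => ?_)).trans_lt ?_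
      · have h2 : ψ o = ρ g (ψ (g⁻¹ • o)) := by rw [← hequiv, smul_inv_smul]
        rw [h2, ← map_sub, hnorm, ← dist_eq_norm, dist_comm]
        exact (hη (g⁻¹ • o)).le
      · simp [hε]
  obtain ⟨θ, h1, h2, h3⟩ := hmem
  convert h1 using 1
  funext p
  obtain ⟨g, rfl⟩ := MulAction.exists_smul_eq G o p
  rw [hequiv, h2, h3]

end EquivariantMaps

/-! ### Covering numbers -/

section Packing

/-- Volume comparison: the balls of radius `δ / 2` about the points are disjoint and lie in the ball
of radius `R + δ / 2` about `c`. -/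
theorem card_le_of_separated_of_subset_ball {W : Type*} [NormedAddCommGroup W] [NormedSpace ℝ W]
    [FiniteDimensional ℝ W] {t : Finset W} {c : W} {R δ : ℝ} (hδ : 0 < δ) (hR : 0 ≤ R)
    (ht : ∀ x ∈ t, dist x c ≤ R)
    (hsep : ∀ x ∈ t, ∀ y ∈ t, x ≠ y → δ ≤ dist x y) :
    (t.card : ℝ) ≤ (2 * R / δ + 1) ^ Module.finrank ℝ W := by
  borelize W
  let ν : Measure W := Measure.addHaar
  have hdisj : (t : Set W).PairwiseDisjoint fun x => Metric.ball x (δ / 2) := by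
    intro x hx y hy hxy
    exact Metric.ball_disjoint_ball (by linarith [hsep x hx y hy hxy])
  have hsub : (⋃ x ∈ t, Metric.ball x (δ / 2)) ⊆ Metric.ball c (R + δ / 2) := by
    refine Set.iUnion₂_subset fun x hx y hy => ?_
    rw [Metric.mem_ball] at hy ⊢
    linarith [dist_triangle y x c, ht x hx]
  have h := measure_mono (μ := ν) hsub
  rw [measure_biUnion_finset hdisj fun x _ => measurableSet_ball] at h
  simp only [Measure.addHaar_ball_of_pos ν _ (by positivity : (0 : ℝ) < δ / 2),
    Measure.addHaar_ball_of_pos ν _ (by positivity : (0 : ℝ) < R + δ / 2), Finset.sum_const,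
    nsmul_eq_mul, ← mul_assoc] at h
  have hb0 : ν (Metric.ball 0 1) ≠ 0 := (Metric.measure_ball_pos ν 0 one_pos).ne'
  have hbt : ν (Metric.ball 0 1) ≠ ⊤ := measure_ball_lt_top.ne
  rw [ENNReal.mul_le_mul_iff_left hb0 hbt, ← ENNReal.ofReal_natCast,
    ← ENNReal.ofReal_mul (by positivity), ENNReal.ofReal_le_ofReal_iff (by positivity)] at h
  have e : (R + δ / 2) = (2 * R / δ + 1) * (δ / 2) := by field_simp
  rw [e, mul_pow] at h
  exact le_of_mul_le_mul_right h (by positivity)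

/-- A compact metric space which locally maps into `W` by continuous expanding maps has polynomially
bounded covering numbers. -/
theorem exists_finset_cover_of_locally_expanding {X W : Type*} [MetricSpace X] [CompactSpace X]
    [NormedAddCommGroup W] [NormedSpace ℝ W] [FiniteDimensional ℝ W]
    (h : ∀ x : X, ∃ f : X → W, ∃ C > 0, ContinuousAt f x ∧
      ∃ s ∈ 𝓝 x, ∀ y ∈ s, ∀ z ∈ s, dist y z ≤ C * dist (f y) (f z)) :
    ∃ C : ℝ, 0 ≤ C ∧ ∀ ε : ℝ, 0 < ε → ε ≤ 1 → ∃ t : Finset X,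
      (t.card : ℝ) ≤ C * (1 / ε) ^ Module.finrank ℝ W ∧ ∀ p, ∃ q ∈ t, dist p q ≤ ε := by
  classical
  have h' : ∀ x : X, ∃ f : X → W, ∃ C > 0, ∃ s ∈ 𝓝 x,
      (∀ y ∈ s, dist (f y) (f x) ≤ 1) ∧
      ∀ y ∈ s, ∀ z ∈ s, dist y z ≤ C * dist (f y) (f z) := by
    intro x
    obtain ⟨f, C, hC, hf, s, hs, hsC⟩ := h x
    refine ⟨f, C, hC, s ∩ f ⁻¹' Metric.ball (f x) 1,
      inter_mem hs (hf (Metric.ball_mem_nhds _ one_pos)), ?_, ?_⟩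
    · intro y hy
      exact (Metric.mem_ball.1 hy.2).le
    · intro y hy z hz
      exact hsC y hy.1 z hz.1
  choose f C hC s hs hf hsC using h'
  obtain ⟨u, hu⟩ := CompactSpace.elim_nhds_subcover s hs
  set d := Module.finrank ℝ W
  have hbound : ∀ ε : ℝ, 0 < ε → ε ≤ 1 → ∀ t : Finset X,
      (∀ x ∈ t, ∀ y ∈ t, x ≠ y → ε ≤ dist x y) →
      (t.card : ℝ) ≤ (∑ x ∈ u, (2 * C x + 1) ^ d) * (1 / ε) ^ d := by
    intro ε hε hε1 t ht
    have h1 : t = u.biUnion fun x => t.filter (· ∈ s x) := by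
      ext p
      simp only [Finset.mem_biUnion, Finset.mem_filter]
      refine ⟨fun hp => ?_, fun ⟨_, _, hp, _⟩ => hp⟩
      have : p ∈ ⋃ x ∈ u, s x := by rw [hu]; trivial
      obtain ⟨x, hx, hpx⟩ := Set.mem_iUnion₂.1 this
      exact ⟨x, hx, hp, hpx⟩
    have h2 : ∀ x ∈ u, ((t.filter (· ∈ s x)).card : ℝ) ≤ (2 * C x + 1) ^ d * (1 / ε) ^ d := by
      intro x _
      have hsep : ∀ p ∈ t.filter (· ∈ s x), ∀ q ∈ t.filter (· ∈ s x), p ≠ q →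
          ε / C x ≤ dist (f x p) (f x q) := by
        intro p hp q hq hpq
        rw [Finset.mem_filter] at hp hq
        rw [div_le_iff₀ (hC x), mul_comm]
        exact (ht p hp.1 q hq.1 hpq).trans (hsC x p hp.2 q hq.2)
      have hpos : 0 < ε / C x := div_pos hε (hC x)
      have hinj : Set.InjOn (f x) (t.filter (· ∈ s x)) := by
        intro p hp q hq hpq
        by_contra hne
        have := hsep p hp q hq hne
        rw [hpq, dist_self] at this
        linarith
      rw [← Finset.card_image_of_injOn hinj, ← mul_pow]
      refine (card_le_of_separated_of_subset_ball (c := f x x) (R := 1) hpos zero_le_one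
        ?_ ?_).trans ?_
      · intro y hy
        obtain ⟨p, hp, rfl⟩ := Finset.mem_image.1 hy
        exact hf x p (Finset.mem_filter.1 hp).2
      · intro y hy z hz hyz
        obtain ⟨p, hp, rfl⟩ := Finset.mem_image.1 hy
        obtain ⟨q, hq, rfl⟩ := Finset.mem_image.1 hz
        exact hsep p hp q hq fun h => hyz (by rw [h])
      · have := hC x
        gcongr
        rw [div_div_eq_mul_div, mul_one_div, le_div_iff₀ hε, add_mul, div_mul_cancel₀ _ hε.ne']
        linarith
    calc (t.card : ℝ) ≤ ∑ x ∈ u, ((t.filter (· ∈ s x)).card : ℝ) := by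
          conv_lhs => rw [h1]
          exact_mod_cast Finset.card_biUnion_le
      _ ≤ ∑ x ∈ u, (2 * C x + 1) ^ d * (1 / ε) ^ d := Finset.sum_le_sum h2
      _ = _ := by rw [Finset.sum_mul]
  refine ⟨∑ x ∈ u, (2 * C x + 1) ^ d,
    Finset.sum_nonneg fun x _ => by have := hC x; positivity, fun ε hε hε1 => ?_⟩
  -- Separated sets have bounded size, so a largest one exists; by maximality it is an `ε`-net.
  let P : ℕ → Prop := fun n => ∃ t : Finset X, t.card = n ∧
    ∀ x ∈ t, ∀ y ∈ t, x ≠ y → ε ≤ dist x y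
  have hP0 : P 0 := ⟨∅, by simp⟩
  set N := ⌊(∑ x ∈ u, (2 * C x + 1) ^ d) * (1 / ε) ^ d⌋₊
  obtain ⟨t, htc, ht⟩ := Nat.findGreatest_spec (P := P) (Nat.zero_le N) hP0
  refine ⟨t, hbound ε hε hε1 t ht, fun p => ?_⟩
  by_contra! hp
  have hpt : p ∉ t := fun h => by
    have := hp p h
    rw [dist_self] at this
    linarith
  have hsep : ∀ x ∈ insert p t, ∀ y ∈ insert p t, x ≠ y → ε ≤ dist x y := by
    intro x hx y hy hxy
    rw [Finset.mem_insert] at hx hy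
    rcases hx with rfl | hx <;> rcases hy with rfl | hy
    · exact absurd rfl hxy
    · exact (hp y hy).le
    · rw [dist_comm]; exact (hp x hx).le
    · exact ht x hx y hy hxy
  have hle : (insert p t).card ≤ N := Nat.le_floor (hbound ε hε hε1 _ hsep)
  have := Nat.le_findGreatest (P := P) hle ⟨_, rfl, hsep⟩
  rw [Finset.card_insert_of_notMem hpt, htc] at this
  omega

end Packing

/-! ### Riemannian distance in a chart -/

section Riemannian

attribute [local instance] normedAddCommGroupTangentSpaceVectorSpace
attribute [local instance] normedSpaceTangentSpaceVectorSpace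

theorem eventually_enorm_mfderivWithin_symm_extChartAt_apply_le {E H M : Type*}
    [NormedAddCommGroup E] [NormedSpace ℝ E] [TopologicalSpace H] (I : ModelWithCorners ℝ E H) [TopologicalSpace M] [ChartedSpace H M]
    [RiemannianBundle (fun x : M => TangentSpace I x)] [IsManifold I 1 M]
    [IsContinuousRiemannianBundle E (fun x : M => TangentSpace I x)] (x : M) :
    ∃ C > (0 : NNReal), ∀ᶠ y in 𝓝[Set.range I] (extChartAt I x x),
    ∀ v : TangentSpace 𝓘(ℝ, E) y, ‖mfderiv[Set.range I] (extChartAt I x).symm y v‖ₑ ≤ C * ‖v‖ₑ := by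
  rcases eventually_enorm_mfderivWithin_symm_extChartAt_lt I x with ⟨C, C_pos, hC⟩
  refine ⟨C, C_pos, ?_⟩
  filter_upwards [hC] with y hy v
  refine LE.le.trans (ContinuousLinearMap.le_opENorm (𝕜 := ℝ) (𝕜₂ := ℝ) _ v) ?_
  gcongr
  exact hy.le

/-- Near any point `x`, the Riemannian distance between two points is controlled by the distance
in the extended chart at `x`. -/
theorem exists_nhds_riemannianEDist_le_edist_extChartAt {E H M : Type*}
    [NormedAddCommGroup E] [NormedSpace ℝ E] [TopologicalSpace H] (I : ModelWithCorners ℝ E H) [TopologicalSpace M] [ChartedSpace H M]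
    [RiemannianBundle (fun x : M => TangentSpace I x)] [IsManifold I 1 M]
    [IsContinuousRiemannianBundle E (fun x : M => TangentSpace I x)] (x : M) :
    ∃ C > (0 : NNReal), ∃ s ∈ 𝓝 x, ∀ y ∈ s, ∀ z ∈ s,
      riemannianEDist I y z ≤ C * edist (extChartAt I x y) (extChartAt I x z) := by
  rcases eventually_enorm_mfderivWithin_symm_extChartAt_apply_le I x with ⟨C, C_pos, hC⟩
  refine ⟨C, C_pos, ?_⟩
  obtain ⟨r, r_pos, hr⟩ : ∃ r > 0,
      Metric.ball (extChartAt I x x) r ∩ Set.range I ⊆ (extChartAt I x).target ∩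
        {y | ∀ v : TangentSpace 𝓘(ℝ, E) y,
          ‖mfderiv[Set.range I] (extChartAt I x).symm y v‖ₑ ≤ C * ‖v‖ₑ} :=
    Metric.mem_nhdsWithin_iff.1 (inter_mem (extChartAt_target_mem_nhdsWithin x) hC)
  have A : (extChartAt I x) ⁻¹' (Metric.ball (extChartAt I x x) r ∩ Set.range I) ∈ 𝓝 x := by
    apply extChartAt_preimage_mem_nhds_of_mem_nhdsWithin (by simp)
    rw [Set.inter_comm]
    exact inter_mem_nhdsWithin _ (Metric.ball_mem_nhds _ r_pos)
  refine ⟨_, inter_mem A (chart_source_mem_nhds H x), ?_⟩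
  rintro z ⟨hz, h'z⟩ y ⟨hy, h'y⟩
  -- The competitor curve is the straight segment in the chart, which stays in the ball by
  -- convexity.
  let η := ContinuousAffineMap.lineMap (R := ℝ) (extChartAt I x z) (extChartAt I x y)
  set γ := (extChartAt I x).symm ∘ η
  have hη : Set.Icc 0 1 ⊆ ⇑η ⁻¹' ((extChartAt I x).target ∩
        {y | ∀ v : TangentSpace 𝓘(ℝ, E) y,
          ‖mfderiv[Set.range I] (extChartAt I x).symm y v‖ₑ ≤ C * ‖v‖ₑ}) := by
    simp only [← Set.image_subset_iff, ContinuousAffineMap.coe_lineMap_eq,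
     ← segment_eq_image_lineMap, η]
    apply Set.Subset.trans _ hr
    exact ((convex_ball _ _).inter I.convex_range).segment_subset hz hy
  simp only [Set.preimage_inter, Set.subset_inter_iff] at hη
  have η_smooth : CMDiff[Set.Icc 0 1] 1 η := by
    apply ContMDiff.contMDiffOn
    rw [contMDiff_iff_contDiff]
    exact ContinuousAffineMap.contDiff _
  have : riemannianEDist I z y ≤ pathELength I γ 0 1 := by
    apply riemannianEDist_le_pathELength _ _ _ zero_le_one
    · exact (contMDiffOn_extChartAt_symm x).comp η_smooth hη.1
    · simp [γ, η, ContinuousAffineMap.coe_lineMap_eq, h'z]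
    · simp [γ, η, ContinuousAffineMap.coe_lineMap_eq, h'y]
  apply this.trans
  rw [← lintegral_fderiv_lineMap_eq_edist, pathELength_eq_lintegral_mfderivWithin_Icc,
    ← lintegral_const_mul' _ _ ENNReal.coe_ne_top]
  apply setLIntegral_mono' measurableSet_Icc (fun t ht ↦ ?_)
  have : mfderiv[Set.Icc 0 1] γ t =
      (mfderiv[Set.range I] (extChartAt I x).symm (η t)) ∘L (mfderiv[Set.Icc 0 1] η t) := by
    apply mfderivWithin_comp
    · exact mdifferentiableWithinAt_extChartAt_symm (hη.1 ht)
    · exact η_smooth.mdifferentiableOn one_ne_zero t ht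
    · exact hη.1.trans (Set.preimage_mono (extChartAt_target_subset_range x))
    · rw [uniqueMDiffWithinAt_iff_uniqueDiffWithinAt]
      exact uniqueDiffOn_Icc zero_lt_one t ht
  have : mfderiv[Set.Icc 0 1] γ t 1 =
      (mfderiv[Set.range I] (extChartAt I x).symm (η t)) (mfderiv[Set.Icc 0 1] η t 1) :=
    congr($this 1)
  rw [this]
  refine (hη.2 ht _).trans (le_of_eq ?_)
  simp only [mfderivWithin_eq_fderivWithin]
  rfl

end Riemannian

/-! ### Schur's lemma -/

section Homothety

variable {T V : Type*} [NormedAddCommGroup T] [InnerProductSpace ℝ T] [FiniteDimensional ℝ T]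
  [NormedAddCommGroup V] [InnerProductSpace ℝ V] [FiniteDimensional ℝ V]

omit [FiniteDimensional ℝ T] [FiniteDimensional ℝ V] in
theorem LinearMap.inner_map_map_of_norm_map_eq (L : T →ₗ[ℝ] V) (γ : T →ₗ[ℝ] T)
    (h : ∀ v, ‖L (γ v)‖ = ‖L v‖) (v w : T) :
    inner ℝ (L (γ v)) (L (γ w)) = inner ℝ (L v) (L w) := by
  rw [real_inner_eq_norm_add_mul_self_sub_norm_mul_self_sub_norm_mul_self_div_two,
    real_inner_eq_norm_add_mul_self_sub_norm_mul_self_sub_norm_mul_self_div_two]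
  simp only [← map_add, h]

/-- **Schur's lemma** for quadratic forms: an invariant quadratic form on an irreducible orthogonal
representation is a multiple of the invariant inner product. -/
theorem LinearMap.exists_norm_eq_mul_norm_of_irreducible (L : T →ₗ[ℝ] V) (Γ : Set (T →ₗ[ℝ] T))
    (hΓ : ∀ γ ∈ Γ, ∀ v, ‖γ v‖ = ‖v‖) (hL : ∀ γ ∈ Γ, ∀ v, ‖L (γ v)‖ = ‖L v‖)
    (hirr : ∀ W : Submodule ℝ T, (∀ γ ∈ Γ, ∀ w ∈ W, γ w ∈ W) → W = ⊥ ∨ W = ⊤) :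
    ∃ s : ℝ, 0 ≤ s ∧ ∀ v, ‖L v‖ = s * ‖v‖ := by
  rcases subsingleton_or_nontrivial T with hT | hT
  · exact ⟨0, le_rfl, fun v => by rw [Subsingleton.elim v 0]; simp⟩
  let A : T →ₗ[ℝ] T := LinearMap.adjoint L ∘ₗ L
  have hA : A.IsSymmetric := by
    intro v w
    simp only [A, LinearMap.comp_apply, LinearMap.adjoint_inner_left,
      LinearMap.adjoint_inner_right]
  have hev := hA.hasEigenvalue_iSup_of_finiteDimensional
  -- The supremum of the Rayleigh quotient is an eigenvalue of `A = L* L`. Its eigenspace is nonzero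
  -- and invariant, hence everything.
  set c : ℝ := ⨆ x : { x : T // x ≠ 0 }, RCLike.re (inner ℝ (A x) (x : T)) / ‖(x : T)‖ ^ 2
  let W : Submodule ℝ T := Module.End.eigenspace A c
  have hW : ∀ γ ∈ Γ, ∀ w ∈ W, γ w ∈ W := by
    intro γ hγ w hw
    have hw' : A w = c • w := Module.End.mem_eigenspace_iff.1 hw
    refine Module.End.mem_eigenspace_iff.2 (ext_inner_right ℝ fun u => ?_)
    let γ' : T →ₗᵢ[ℝ] T := ⟨γ, hΓ γ hγ⟩
    -- An isometry of a finite dimensional space is onto, so testing against vectors `γ v` suffices,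
    -- and there invariance applies to both arguments.
    obtain ⟨v, rfl⟩ := (γ'.toLinearIsometryEquiv rfl).surjective u
    change inner ℝ (A (γ w)) (γ v) = inner ℝ (c • γ' w) (γ' v)
    rw [inner_smul_left, γ'.inner_map_map]
    simp only [A, LinearMap.comp_apply, LinearMap.adjoint_inner_left]
    rw [L.inner_map_map_of_norm_map_eq γ (hL γ hγ), ← LinearMap.adjoint_inner_left,
      ← LinearMap.comp_apply]
    change inner ℝ (A w) v = _
    rw [hw', inner_smul_left]
  have htop : W = ⊤ := (hirr W hW).resolve_left fun h => hev h
  have hsq : ∀ v, ‖L v‖ ^ 2 = c * ‖v‖ ^ 2 := by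
    intro v
    have hv : v ∈ W := htop ▸ Submodule.mem_top
    have hv' : A v = c • v := Module.End.mem_eigenspace_iff.1 hv
    rw [← real_inner_self_eq_norm_sq, ← real_inner_self_eq_norm_sq,
      ← LinearMap.adjoint_inner_left]
    change inner ℝ (A v) v = _
    rw [hv', real_inner_smul_left]
  have hc : 0 ≤ c := by
    obtain ⟨v, hv⟩ := exists_ne (0 : T)
    have := hsq v
    have hv2 : 0 < ‖v‖ ^ 2 := by positivity
    nlinarith [sq_nonneg ‖L v‖]
  refine ⟨√c, Real.sqrt_nonneg _, fun v => ?_⟩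
  rw [← Real.sqrt_sq (norm_nonneg (L v)), hsq, Real.sqrt_mul hc, Real.sqrt_sq (norm_nonneg v)]

end Homothety

/-! ### Covering numbers of `M`, Lipschitz bounds and homotheties -/

section Riemannian

variable {m : ℕ} {M : Type*} [MetricSpace M] [ChartedSpace (EuclideanSpace ℝ (Fin m)) M]
  [IsManifold (𝓡 m) ∞ M]
  [RiemannianBundle (fun p : M => TangentSpace (𝓡 m) p)]

theorem exists_finset_cover_of_isRiemannianManifold
    [IsContMDiffRiemannianBundle (𝓡 m) ∞ (EuclideanSpace ℝ (Fin m))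
      (fun p : M => TangentSpace (𝓡 m) p)]
    [IsRiemannianManifold (𝓡 m) M] [CompactSpace M] :
    ∃ C : ℝ, 0 ≤ C ∧ ∀ ε : ℝ, 0 < ε → ε ≤ 1 → ∃ t : Finset M,
      (t.card : ℝ) ≤ C * (1 / ε) ^ m ∧ ∀ p, ∃ q ∈ t, dist p q ≤ ε := by
  have : IsManifold (𝓡 m) 1 M := .of_le (n := ∞) (by simp)
  have : IsContinuousRiemannianBundle (EuclideanSpace ℝ (Fin m))
      (fun p : M => TangentSpace (𝓡 m) p) := by
    obtain ⟨g, hg, h⟩ := IsContMDiffRiemannianBundle.exists_contMDiff (IB := 𝓡 m) (n := ∞)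
      (F := EuclideanSpace ℝ (Fin m)) (E := fun p : M => TangentSpace (𝓡 m) p)
    exact ⟨g, hg.continuous, h⟩
  have h := exists_finset_cover_of_locally_expanding (X := M) (W := EuclideanSpace ℝ (Fin m)) ?_
  · simpa using h
  intro x
  obtain ⟨C, hC, s, hs, h⟩ := exists_nhds_riemannianEDist_le_edist_extChartAt (𝓡 m) x
  refine ⟨extChartAt (𝓡 m) x, C, hC, continuousAt_extChartAt x, s, hs, fun y hy z hz => ?_⟩
  have h1 := h y hy z hz
  rw [← IsRiemannianManifold.out, edist_dist, edist_dist, ← ENNReal.ofReal_coe_nnreal,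
    ← ENNReal.ofReal_mul C.coe_nonneg,
    ENNReal.ofReal_le_ofReal_iff (by positivity)] at h1
  exact h1

omit [IsManifold (𝓡 m) ∞ M] in
theorem norm_sub_le_mul_dist_of_norm_mfderiv_le [IsRiemannianManifold (𝓡 m) M]
    {V : Type*} [NormedAddCommGroup V] [NormedSpace ℝ V] [CompleteSpace V] {f : M → V}
    (hf : ContMDiff (𝓡 m) 𝓘(ℝ, V) 1 f) {s : ℝ} (hs : 0 ≤ s)
    (hd : ∀ (p : M) (v : TangentSpace (𝓡 m) p),
      let w : V := mfderiv (𝓡 m) 𝓘(ℝ, V) f p v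
      ‖w‖ ≤ s * ‖v‖) (x y : M) :
    ‖f y - f x‖ ≤ s * dist x y := by
  -- No minimizing curve is required: a curve of length below `r` exists for every `r > dist x y`,
  -- and `r` is then sent to the distance.
  have key : ∀ r : ℝ, dist x y < r → ‖f y - f x‖ ≤ s * r := by
    intro r hr
    have hr0 : 0 ≤ r := dist_nonneg.trans hr.le
    have h1 : riemannianEDist (𝓡 m) x y < ENNReal.ofReal r := by
      rw [← IsRiemannianManifold.out, edist_dist]
      exact (ENNReal.ofReal_lt_ofReal_iff_of_nonneg dist_nonneg).2 hr
    obtain ⟨γ, h0, h1, hγ, hlen⟩ := exists_lt_of_riemannianEDist_lt h1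
    have hcd : ContDiffOn ℝ 1 (f ∘ γ) (Set.Icc 0 1) :=
      contMDiffOn_iff_contDiffOn.1 (hf.comp_contMDiffOn hγ)
    have h2 := enorm_sub_le_lintegral_derivWithin_Icc_of_contDiffOn_Icc hcd zero_le_one
    have h3 : ∫⁻ t in Set.Icc (0 : ℝ) 1, ‖derivWithin (f ∘ γ) (Set.Icc 0 1) t‖ₑ ≤
        ENNReal.ofReal s * pathELength (𝓡 m) γ 0 1 := by
      rw [pathELength_eq_lintegral_mfderivWithin_Icc, ← lintegral_const_mul' _ _ ENNReal.ofReal_ne_top]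
      refine setLIntegral_mono' measurableSet_Icc fun t ht => ?_
      have e : mfderivWithin 𝓘(ℝ, ℝ) 𝓘(ℝ, V) (f ∘ γ) (Set.Icc 0 1) t =
          (mfderiv (𝓡 m) 𝓘(ℝ, V) f (γ t)).comp
            (mfderivWithin 𝓘(ℝ, ℝ) (𝓡 m) γ (Set.Icc 0 1) t) := by
        refine mfderiv_comp_mfderivWithin t (hf.mdifferentiableAt one_ne_zero)
          (hγ.mdifferentiableOn one_ne_zero t ht) ?_
        rw [uniqueMDiffWithinAt_iff_uniqueDiffWithinAt]
        exact uniqueDiffOn_Icc zero_lt_one t ht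
      have e2 : derivWithin (f ∘ γ) (Set.Icc 0 1) t =
          mfderiv (𝓡 m) 𝓘(ℝ, V) f (γ t) (mfderivWithin 𝓘(ℝ, ℝ) (𝓡 m) γ (Set.Icc 0 1) t 1) := by
        rw [← fderivWithin_derivWithin, ← mfderivWithin_eq_fderivWithin, e]
        rfl
      have h4 : ‖derivWithin (f ∘ γ) (Set.Icc 0 1) t‖ ≤
          s * ‖mfderivWithin 𝓘(ℝ, ℝ) (𝓡 m) γ (Set.Icc 0 1) t 1‖ := by
        rw [e2]
        exact hd (γ t) (mfderivWithin 𝓘(ℝ, ℝ) (𝓡 m) γ (Set.Icc 0 1) t 1)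
      have h5 := ENNReal.ofReal_le_ofReal h4
      rw [ENNReal.ofReal_mul hs, ofReal_norm, ofReal_norm] at h5
      exact h5
    have h6 : ‖f y - f x‖ₑ ≤ ENNReal.ofReal s * ENNReal.ofReal r := by
      simp only [Function.comp_apply, h0, h1] at h2
      exact (h2.trans h3).trans (by gcongr)
    rw [← ofReal_norm, ← ENNReal.ofReal_mul hs, ENNReal.ofReal_le_ofReal_iff (by positivity)] at h6
    exact h6
  have hlim : Tendsto (fun r : ℝ => s * r) (𝓝[>] dist x y) (𝓝 (s * dist x y)) :=
    (tendsto_const_nhds.mul tendsto_id).mono_left nhdsWithin_le_nhds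
  refine ge_of_tendsto hlim ?_
  filter_upwards [self_mem_nhdsWithin] with r hr using key r hr

/-- A `C¹` map which intertwines an isometric, transitive and isotropy irreducible action with a
representation by linear isometries is an infinitesimal homothety. -/
theorem exists_norm_mfderiv_eq_mul_norm {G : Type*} [Group G] [MulAction G M]
    [MulAction.IsPretransitive G M]
    (hsmooth : ∀ g : G, ContMDiff (𝓡 m) (𝓡 m) ∞ fun p : M => g • p)
    (hiso : ActsByIsometries m G M) {o : M} (hirr : IsotropyIrreducible m G o)
    {V : Type*} [NormedAddCommGroup V] [InnerProductSpace ℝ V] [FiniteDimensional ℝ V]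
    {ρ : G → V →L[ℝ] V} (hρ : ∀ g v, ‖ρ g v‖ = ‖v‖) {f : M → V}
    (hf : ContMDiff (𝓡 m) 𝓘(ℝ, V) 1 f) (hequiv : ∀ (g : G) p, f (g • p) = ρ g (f p)) :
    ∃ s : ℝ, 0 ≤ s ∧ ∀ (p : M) (v : TangentSpace (𝓡 m) p),
      let w : V := mfderiv (𝓡 m) 𝓘(ℝ, V) f p v
      ‖w‖ = s * ‖v‖ := by
  have hmf : MDifferentiable (𝓡 m) 𝓘(ℝ, V) f := hf.mdifferentiable one_ne_zero
  have hmg : ∀ g : G, MDifferentiable (𝓡 m) (𝓡 m) fun p : M => g • p :=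
    fun g => (hsmooth g).mdifferentiable (by simp)
  have hchain : ∀ (g : G) (p : M) (v : TangentSpace (𝓡 m) p),
      (mfderiv (𝓡 m) 𝓘(ℝ, V) f (g • p) (mfderiv (𝓡 m) (𝓡 m) (fun q : M => g • q) p v) : V) =
        ρ g (mfderiv (𝓡 m) 𝓘(ℝ, V) f p v) := by
    intro g p v
    have e1 := mfderiv_comp p (hmf (g • p)) (hmg g p)
    have e2 := mfderiv_comp p ((ρ g).contMDiff.mdifferentiable (n := 1) one_ne_zero (f p)) (hmf p)
    have e3 : f ∘ (fun q : M => g • q) = (ρ g) ∘ f := funext fun q => hequiv g q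
    rw [e3, e2] at e1
    have e4 := congrArg (fun L => L v) e1
    have e5 : mfderiv 𝓘(ℝ, V) 𝓘(ℝ, V) (ρ g) (f p) = ρ g := by
      rw [mfderiv_eq_fderiv]; exact (ρ g).fderiv
    rw [e5] at e4
    exact e4.symm
  -- All tangent spaces are the same type, but the norm depends on the base point; this transports
  -- it along `h • o = o`.
  have hfib : ∀ (p q : M) (v : EuclideanSpace ℝ (Fin m)), p = q →
      ‖(show TangentSpace (𝓡 m) p from v)‖ = ‖(show TangentSpace (𝓡 m) q from v)‖ := by
    rintro p _ v rfl
    rfl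
  have hfd : FiniteDimensional ℝ (TangentSpace (𝓡 m) o) :=
    inferInstanceAs (FiniteDimensional ℝ (EuclideanSpace ℝ (Fin m)))
  let D : G → (TangentSpace (𝓡 m) o →ₗ[ℝ] TangentSpace (𝓡 m) o) := fun h =>
    (mfderiv (𝓡 m) (𝓡 m) (fun q : M => h • q) o).toLinearMap
  let L : TangentSpace (𝓡 m) o →ₗ[ℝ] V := (mfderiv (𝓡 m) 𝓘(ℝ, V) f o).toLinearMap
  have hfib' : ∀ (p q : M) (v : EuclideanSpace ℝ (Fin m)), p = q →
      (mfderiv (𝓡 m) 𝓘(ℝ, V) f p v : V) = mfderiv (𝓡 m) 𝓘(ℝ, V) f q v := by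
    rintro p _ v rfl
    rfl
  have key : ∃ s : ℝ, 0 ≤ s ∧ ∀ v, ‖L v‖ = s * ‖v‖ := by
    refine L.exists_norm_eq_mul_norm_of_irreducible
      (D '' (MulAction.stabilizer G o : Set G)) ?_ ?_ ?_
    · rintro _ ⟨h, hh, rfl⟩ v
      exact (hfib o (h • o) _ hh.symm).trans (hiso h o v)
    · rintro _ ⟨h, hh, rfl⟩ v
      have hh : h • o = o := hh
      have e : L (D h v) = ρ h (L v) := (hfib' o (h • o) _ hh.symm).trans (hchain h o v)
      rw [e, hρ]
    · intro W hW
      exact hirr W fun h hh w hw => hW _ ⟨h, hh, rfl⟩ w hw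
  obtain ⟨s, hs, hsL⟩ := key
  refine ⟨s, hs, fun p v => ?_⟩
  obtain ⟨g, rfl⟩ := MulAction.exists_smul_eq G o p
  -- The differential of `g` is an isometry between spaces of equal dimension, so every vector at `g
  -- • o` comes from one at `o`, where `s` was found.
  let Dg : EuclideanSpace ℝ (Fin m) →ₗ[ℝ] EuclideanSpace ℝ (Fin m) :=
    (mfderiv (𝓡 m) (𝓡 m) (fun q : M => g • q) o).toLinearMap
  have hinj : Function.Injective Dg := by
    refine (injective_iff_map_eq_zero Dg).2 fun v hv => ?_
    have h1 := hiso g o v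
    have h2 : ‖mfderiv (𝓡 m) (𝓡 m) (fun q : M => g • q) o v‖ = 0 := by
      have h3 : mfderiv (𝓡 m) (𝓡 m) (fun q : M => g • q) o v = 0 := hv
      rw [h3, norm_zero]
    rw [h2] at h1
    exact (norm_eq_zero (E := TangentSpace (𝓡 m) o)).1 h1.symm
  obtain ⟨v', hv'⟩ := LinearMap.surjective_of_injective hinj v
  have hv' : mfderiv (𝓡 m) (𝓡 m) (fun q : M => g • q) o v' = v := hv'
  rw [← hv', hiso g o v']
  have e : (mfderiv (𝓡 m) 𝓘(ℝ, V) f (g • o)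
      (mfderiv (𝓡 m) (𝓡 m) (fun q : M => g • q) o v') : V) = ρ g (L v') := hchain g o v'
  refine (congrArg (fun w : V => ‖w‖) e).trans ?_
  exact (hρ g (L v')).trans (hsL v')

end Riemannian

/-! ### The representation on `E` and the evaluation vectors -/

namespace InvSpace

section Rep

variable {G M : Type*} [Group G] [MulAction G M] [MeasurableSpace M] {μ : Measure M}
  [MeasurableConstSMul G M] [SMulInvariantMeasure G M μ]

theorem smul_mem_carrier (E : InvSpace G μ) (g : G) {u : Lp ℝ 2 μ} (hu : u ∈ E.carrier) :
    DomMulAct.mk g • u ∈ E.carrier := by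
  obtain ⟨v, hv, hvu⟩ := E.invariant g u hu
  have : DomMulAct.mk g • u = v := Lp.ext ((DomMulAct.smul_Lp_ae_eq _ u).trans hvu.symm)
  rwa [this]

/-- The representation of `G` on `E` by `(g • u)(p) = u(g⁻¹ • p)`. -/
noncomputable def rep (E : InvSpace G μ) : G →* (E.carrier →L[ℝ] E.carrier) where
  toFun g := LinearMap.toContinuousLinearMap
    { toFun := fun u => ⟨DomMulAct.mk g⁻¹ • (u : Lp ℝ 2 μ), E.smul_mem_carrier g⁻¹ u.2⟩
      map_add' := fun u v => Subtype.ext (smul_add _ (u : Lp ℝ 2 μ) (v : Lp ℝ 2 μ))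
      map_smul' := fun c u => Subtype.ext (smul_comm _ c (u : Lp ℝ 2 μ)) }
  map_one' := by
    ext1 u
    refine Subtype.ext ?_
    change DomMulAct.mk (1 : G)⁻¹ • (u : Lp ℝ 2 μ) = u
    rw [inv_one, DomMulAct.mk_one, one_smul]
  map_mul' g h := by
    ext1 u
    refine Subtype.ext ?_
    change DomMulAct.mk (g * h)⁻¹ • (u : Lp ℝ 2 μ) =
      DomMulAct.mk g⁻¹ • DomMulAct.mk h⁻¹ • (u : Lp ℝ 2 μ)
    rw [mul_inv_rev, DomMulAct.mk_mul, mul_smul]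

theorem norm_rep_apply (E : InvSpace G μ) (g : G) (u : E.carrier) : ‖E.rep g u‖ = ‖u‖ :=
  DomMulAct.norm_smul_Lp (DomMulAct.mk g⁻¹) (u : Lp ℝ 2 μ)

theorem rep_inv_rep (E : InvSpace G μ) (g : G) (u : E.carrier) : E.rep g⁻¹ (E.rep g u) = u := by
  change (E.rep g⁻¹ * E.rep g) u = u
  rw [← map_mul, inv_mul_cancel, map_one]
  rfl

theorem rep_rep_inv (E : InvSpace G μ) (g : G) (u : E.carrier) : E.rep g (E.rep g⁻¹ u) = u := by
  change (E.rep g * E.rep g⁻¹) u = u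
  rw [← map_mul, mul_inv_cancel, map_one]
  rfl

theorem inner_rep_rep (E : InvSpace G μ) (g : G) (u v : E.carrier) :
    inner ℝ (E.rep g u) (E.rep g v) = inner ℝ u v := by
  let γ : E.carrier →ₗᵢ[ℝ] E.carrier := ⟨(E.rep g).toLinearMap, E.norm_rep_apply g⟩
  exact γ.inner_map_map u v

theorem inner_rep_left (E : InvSpace G μ) (g : G) (u v : E.carrier) :
    inner ℝ (E.rep g u) v = inner ℝ u (E.rep g⁻¹ v) := by
  conv_lhs => rw [← E.rep_rep_inv g v]
  exact E.inner_rep_rep g _ _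

theorem rep_apply_ae_eq (E : InvSpace G μ) (g : G) (u : E.carrier) :
    (E.rep g u : Lp ℝ 2 μ) =ᵐ[μ] fun p => (u : Lp ℝ 2 μ) (g⁻¹ • p) :=
  DomMulAct.smul_Lp_ae_eq (DomMulAct.mk g⁻¹) (u : Lp ℝ 2 μ)

/-- A measurable map `M → E` representing the evaluations almost everywhere. -/
noncomputable def aeEvalVec (E : InvSpace G μ) (p : M) : E.carrier :=
  ∑ i, ((stdOrthonormalBasis ℝ E.carrier i : E.carrier) : Lp ℝ 2 μ) p •
    stdOrthonormalBasis ℝ E.carrier i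

omit [MeasurableConstSMul G M] [SMulInvariantMeasure G M μ] in
theorem stronglyMeasurable_aeEvalVec (E : InvSpace G μ) : StronglyMeasurable E.aeEvalVec :=
  Finset.stronglyMeasurable_fun_sum _ fun _ _ => (Lp.stronglyMeasurable _).smul_const _

omit [MeasurableConstSMul G M] [SMulInvariantMeasure G M μ] in
theorem inner_aeEvalVec_ae_eq (E : InvSpace G μ) (u : E.carrier) :
    (u : Lp ℝ 2 μ) =ᵐ[μ] fun p => inner ℝ (E.aeEvalVec p) u := by
  set b := stdOrthonormalBasis ℝ E.carrier
  have h : ∀ s : Finset (Fin (Module.finrank ℝ E.carrier)),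
      ((∑ i ∈ s, inner ℝ (b i) u • b i : E.carrier) : Lp ℝ 2 μ) =ᵐ[μ]
        fun p => ∑ i ∈ s, inner ℝ (b i) u * ((b i : E.carrier) : Lp ℝ 2 μ) p := by
    intro s
    induction s using Finset.induction_on with
    | empty =>
      simp only [Finset.sum_empty]
      exact Lp.coeFn_zero ℝ 2 μ
    | insert i s his ih =>
      rw [Finset.sum_insert his, Submodule.coe_add, Submodule.coe_smul]
      filter_upwards [Lp.coeFn_add (inner ℝ (b i) u • ((b i : E.carrier) : Lp ℝ 2 μ))
        ((∑ i ∈ s, inner ℝ (b i) u • b i : E.carrier) : Lp ℝ 2 μ),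
        Lp.coeFn_smul (inner ℝ (b i) u) ((b i : E.carrier) : Lp ℝ 2 μ), ih] with p h1 h2 h3
      rw [h1, Pi.add_apply, h2, h3, Finset.sum_insert his, Pi.smul_apply, smul_eq_mul]
  have h1 := h Finset.univ
  rw [b.sum_repr' u] at h1
  filter_upwards [h1] with p hp
  rw [hp, aeEvalVec, sum_inner]
  refine Finset.sum_congr rfl fun i _ => ?_
  rw [mul_comm]
  exact (real_inner_smul_left _ _ _).symm

/-- Both sides represent evaluation almost everywhere. The exceptional null set depends on `g`, so
this is not yet equivariance. -/
theorem rep_aeEvalVec_inv_smul_ae_eq (E : InvSpace G μ) (g : G) :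
    (fun p => E.rep g (E.aeEvalVec (g⁻¹ • p))) =ᵐ[μ] E.aeEvalVec := by
  set b := stdOrthonormalBasis ℝ E.carrier
  have h : ∀ i, ∀ᵐ p ∂μ, inner ℝ (E.rep g (E.aeEvalVec (g⁻¹ • p))) (b i) =
      inner ℝ (E.aeEvalVec p) (b i) := by
    intro i
    have h1 := (measurePreserving_smul g⁻¹ μ).quasiMeasurePreserving.ae_eq_comp
      (E.inner_aeEvalVec_ae_eq (E.rep g⁻¹ (b i)))
    have h2 := (measurePreserving_smul g⁻¹ μ).quasiMeasurePreserving.ae_eq_comp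
      (E.rep_apply_ae_eq g⁻¹ (b i))
    filter_upwards [h1, h2, E.inner_aeEvalVec_ae_eq (b i)] with p h1 h2 h3
    simp only [Function.comp_apply, inv_inv, smul_inv_smul] at h1 h2
    rw [E.inner_rep_left, ← h1, h2, h3]
  filter_upwards [ae_all_iff.2 h] with p hp
  exact InnerProductSpace.ext_inner_right_basis b.toBasis fun i => by simpa using hp i

end Rep

section Eval

variable {G M : Type*} [Group G] [TopologicalSpace G] [IsTopologicalGroup G] [CompactSpace G]
  [MetricSpace M] [CompactSpace M] [MeasurableSpace M] [BorelSpace M]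
  [MulAction G M] [ContinuousSMul G M] [MulAction.IsPretransitive G M]
  {μ : Measure M} [IsProbabilityMeasure μ] [SMulInvariantMeasure G M μ]

omit [CompactSpace G] [MulAction.IsPretransitive G M] in
theorem continuous_rep (E : InvSpace G μ) : Continuous E.rep := by
  borelize G
  refine continuous_clm_apply.2 fun u => ?_
  refine Continuous.subtype_mk ?_ _
  have hmk : Continuous fun g : G => DomMulAct.mk g⁻¹ :=
    DomMulAct.continuous_mk.comp continuous_inv
  have : Fact ((2 : ℝ≥0∞) ≠ ⊤) := ⟨by simp⟩
  have hc : ContinuousSMul Gᵈᵐᵃ (Lp ℝ 2 μ) := inferInstance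
  exact hmk.smul continuous_const

omit [IsTopologicalGroup G] [CompactSpace M] [MeasurableSpace M] [BorelSpace M] in
-- The orbit map from the compact `G` onto the Hausdorff `M` is a quotient map, and along it `ψ`
-- becomes `g ↦ ρ g (ψ o)`.
theorem _root_.continuous_of_equivariant {V : Type*} [NormedAddCommGroup V] [NormedSpace ℝ V]
    {ρ : G → V →L[ℝ] V} (hρ : Continuous ρ) {ψ : M → V}
    (h : ∀ (g : G) p, ψ (g • p) = ρ g (ψ p)) : Continuous ψ := by
  rcases isEmpty_or_nonempty M with hM | ⟨⟨o⟩⟩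
  · exact continuous_of_const fun p => (hM.false p).elim
  have hc : Continuous fun g : G => g • o := by fun_prop
  have hq : IsQuotientMap fun g : G => g • o :=
    hc.isClosedMap.isQuotientMap hc (MulAction.surjective_smul G o)
  rw [hq.continuous_iff]
  have : ψ ∘ (fun g : G => g • o) = fun g => ρ g (ψ o) := funext fun g => h g o
  rw [this]
  exact hρ.clm_apply continuous_const

omit [Group G] [IsTopologicalGroup G] [CompactSpace G] [MetricSpace M] [CompactSpace M]
  [BorelSpace M] [MulAction G M] [ContinuousSMul G M] [MulAction.IsPretransitive G M] in
theorem _root_.stronglyMeasurable_clm_apply_fst [MeasurableSpace G] [BorelSpace G] {V : Type*}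
    [NormedAddCommGroup V] [NormedSpace ℝ V] [FiniteDimensional ℝ V]
    {ρ : G → V →L[ℝ] V} (hρ : Continuous ρ) {f : G × M → V} (hf : StronglyMeasurable f) :
    StronglyMeasurable fun q : G × M => ρ q.1 (f q) :=
  (isBoundedBilinearMap_apply (𝕜 := ℝ) (E := V) (F := V)).continuous.comp_stronglyMeasurable
    ((hρ.stronglyMeasurable.comp_measurable measurable_fst).prodMk hf)

omit [MulAction.IsPretransitive G M] in
/-- There is an equivariant map `M → E` representing the evaluations almost everywhere. -/
theorem exists_equivariant_evalVec (E : InvSpace G μ) : ∃ Φ : M → E.carrier,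
    (∀ (g : G) p, Φ (g • p) = E.rep g (Φ p)) ∧
    ∀ u : E.carrier, (u : Lp ℝ 2 μ) =ᵐ[μ] fun p => inner ℝ (Φ p) u := by
  borelize G
  let K₀ : TopologicalSpace.PositiveCompacts G := ⊤
  let ν : Measure G := Measure.haarMeasure K₀
  have : IsProbabilityMeasure ν := ⟨by
    simpa [K₀] using Measure.haarMeasure_self (K₀ := K₀)⟩
  have hsmul : Measurable fun q : G × M => q.1⁻¹ • q.2 := by
    have : Continuous fun q : G × M => q.1⁻¹ • q.2 := by fun_prop
    exact this.measurable
  have hmeas : StronglyMeasurable fun q : G × M => E.rep q.1 (E.aeEvalVec (q.1⁻¹ • q.2)) := by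
    exact stronglyMeasurable_clm_apply_fst E.continuous_rep
      (E.stronglyMeasurable_aeEvalVec.comp_measurable hsmul)
  refine ⟨fun p => ∫ g, E.rep g (E.aeEvalVec (g⁻¹ • p)) ∂ν, fun x p => ?_, fun u => ?_⟩
  -- A continuous linear equivalence commutes with the integral even without integrability, which is
  -- not known at every single `p`.
  · let A : E.carrier ≃L[ℝ] E.carrier := ContinuousLinearEquiv.equivOfInverse (E.rep x)
      (E.rep x⁻¹) (E.rep_inv_rep x) (E.rep_rep_inv x)
    dsimp only
    rw [← integral_mul_left_eq_self (fun g => E.rep g (E.aeEvalVec (g⁻¹ • x • p))) x]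
    simp only [mul_inv_rev, map_mul, mul_smul, inv_smul_smul]
    exact A.integral_comp_comm _
  · have hset : MeasurableSet {q : G × M | E.rep q.1 (E.aeEvalVec (q.1⁻¹ • q.2)) =
        E.aeEvalVec q.2} :=
      hmeas.measurableSet_eq_fun (E.stronglyMeasurable_aeEvalVec.comp_measurable measurable_snd)
    have h1 : ∀ᵐ g ∂ν, ∀ᵐ p ∂μ, E.rep g (E.aeEvalVec (g⁻¹ • p)) = E.aeEvalVec p :=
      .of_forall fun g => E.rep_aeEvalVec_inv_smul_ae_eq g
    -- Fubini exchanges the quantifiers: for almost every `p` the integrand is constant in almost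
    -- every `g`, so averaging changes nothing there.
    have h2 : ∀ᵐ p ∂μ, ∀ᵐ g ∂ν, E.rep g (E.aeEvalVec (g⁻¹ • p)) = E.aeEvalVec p :=
      (Measure.ae_ae_comm hset).1 h1
    filter_upwards [h2, E.inner_aeEvalVec_ae_eq u] with p hp hu
    rw [hu, integral_congr_ae hp]
    simp

/-- The equivariant representative is continuous, so the choice in `evalVec` succeeds and its
default `0` never occurs. -/
theorem evalVec_spec (E : InvSpace G μ) (u : E.carrier) :
    Continuous (fun p => inner ℝ (E.evalVec p) u) ∧
      (u : Lp ℝ 2 μ) =ᵐ[μ] fun p => inner ℝ (E.evalVec p) u := by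
  obtain ⟨Φ, h1, h2⟩ := E.exists_equivariant_evalVec
  have hex : ∃ Φ : M → E.carrier, ∀ u : E.carrier,
      Continuous (fun p => inner ℝ (Φ p) u) ∧
      (u : Lp ℝ 2 μ) =ᵐ[μ] fun p => inner ℝ (Φ p) u :=
    ⟨Φ, fun u => ⟨(continuous_of_equivariant E.continuous_rep h1).inner continuous_const, h2 u⟩⟩
  rw [evalVec, dif_pos hex]
  exact hex.choose_spec u

/-- An invariant probability measure charges every nonempty open set. Continuous representatives are
therefore unique, and `evalVec` is the equivariant map. -/
theorem evalVec_smul (E : InvSpace G μ) (g : G) (p : M) :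
    E.evalVec (g • p) = E.rep g (E.evalVec p) := by
  obtain ⟨Φ, h1, h2⟩ := E.exists_equivariant_evalVec
  have : μ.IsOpenPosMeasure := ⟨fun U hU hne =>
    (measure_isOpen_pos_of_smulInvariant_of_compact_ne_zero G (μ := μ) isCompact_univ (by simp)
      hU hne).ne'⟩
  have hΦ : E.evalVec = Φ := by
    funext p
    refine ext_inner_right ℝ fun u => ?_
    have hc := (continuous_of_equivariant E.continuous_rep h1).inner (𝕜 := ℝ)
      (continuous_const (y := u))
    exact congrFun (((E.evalVec_spec u).1.ae_eq_iff_eq μ hc).1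
      ((E.evalVec_spec u).2.symm.trans (h2 u))) p
  rw [hΦ]
  exact h1 g p

theorem continuous_evalVec (E : InvSpace G μ) : Continuous E.evalVec :=
  continuous_of_equivariant E.continuous_rep E.evalVec_smul

/-- By transitivity the norm is constant, and `|φ_p|² = ∑ i, b_i(p)²` has integral `dim E` for an
orthonormal basis `b`. -/
theorem norm_evalVec (E : InvSpace G μ) (p : M) : ‖E.evalVec p‖ = √(E.dim : ℝ) := by
  set b := stdOrthonormalBasis ℝ E.carrier
  have hconst : ∀ q, ‖E.evalVec q‖ = ‖E.evalVec p‖ := by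
    intro q
    obtain ⟨g, rfl⟩ := MulAction.exists_smul_eq G p q
    rw [E.evalVec_smul, E.norm_rep_apply]
  have hint : ∀ i, Integrable (fun q => (inner ℝ (E.evalVec q) (b i)) ^ 2) μ := fun i =>
    ((E.evalVec_spec (b i)).1.pow 2).integrable_of_hasCompactSupport
      (HasCompactSupport.of_compactSpace _)
  have h1 : ∀ i, ∫ q, (inner ℝ (E.evalVec q) (b i)) ^ 2 ∂μ = 1 := by
    intro i
    have h2 : inner ℝ ((b i : E.carrier) : Lp ℝ 2 μ) ((b i : E.carrier) : Lp ℝ 2 μ) = (1 : ℝ) := by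
      rw [real_inner_self_eq_norm_sq]
      have : ‖((b i : E.carrier) : Lp ℝ 2 μ)‖ = 1 := b.norm_eq_one i
      rw [this, one_pow]
    rw [← h2, L2.inner_def]
    refine integral_congr_ae ?_
    filter_upwards [(E.evalVec_spec (b i)).2] with q hq
    rw [← hq]
    simp [sq]
  have h3 : ∫ q, ‖E.evalVec q‖ ^ 2 ∂μ = E.dim := by
    have : ∀ q, ‖E.evalVec q‖ ^ 2 = ∑ i, (inner ℝ (E.evalVec q) (b i)) ^ 2 := by
      intro q
      rw [← b.sum_sq_norm_inner_left (E.evalVec q)]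
      simp
    simp_rw [this]
    rw [integral_finsetSum _ fun i _ => hint i]
    rw [Finset.sum_congr rfl fun i _ => h1 i]
    simp [dim]
  simp_rw [hconst] at h3
  simp only [integral_const, probReal_univ, one_smul] at h3
  rw [← h3, Real.sqrt_sq (norm_nonneg _)]

end Eval

end InvSpace

/-! ### Sphere moments against Gaussian moments -/

/-- The average of `|c u₁| ^ a` over the unit sphere of `ℝⁿ`, where `c = √n`. -/
noncomputable def sphereMoment (n : ℕ) (a : ℝ) : ℝ :=
  √(n : ℝ) ^ a * (Real.Gamma ((a + 1) / 2) * Real.Gamma (n / 2) /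
    (√Real.pi * Real.Gamma ((n + a) / 2)))

theorem sphereMoment_eq {n : ℕ} (a : ℝ) :
    sphereMoment n a = gaussianAbsMoment a *
      ((n / 2 : ℝ) ^ (a / 2) * Real.Gamma (n / 2) / Real.Gamma (n / 2 + a / 2)) := by
  have h : √(n : ℝ) ^ a = 2 ^ (a / 2) * (n / 2 : ℝ) ^ (a / 2) := by
    rw [← Real.mul_rpow (by norm_num) (by positivity), Real.sqrt_eq_rpow,
      ← Real.rpow_mul (by positivity), mul_div_cancel₀ _ two_ne_zero]
    congr 1
    ring
  rw [sphereMoment, gaussianAbsMoment, h, ← add_div]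
  have := Real.sqrt_pos.2 Real.pi_pos
  field_simp

theorem tendsto_sphereMoment {a : ℝ} (ha : -1 < a) :
    Tendsto (fun n : ℕ => sphereMoment n a) atTop (𝓝 (gaussianAbsMoment a)) := by
  have h := Real.tendsto_rpow_mul_Gamma_div_Gamma_add (b := a / 2) (by linarith)
  have h2 : Tendsto (fun n : ℕ => (n / 2 : ℝ)) atTop atTop :=
    tendsto_natCast_atTop_atTop.atTop_div_const two_pos
  have h3 := (h.comp h2).const_mul (gaussianAbsMoment a)
  rw [mul_one] at h3
  exact h3.congr fun n => (sphereMoment_eq a).symm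

/-- The Gamma ratio at `y = n / 2`, `b = a / 2` is at most `1` once `b ≥ 1`; this is where `a ≥ 2`
enters. -/
theorem sphereMoment_le {n : ℕ} (hn : 0 < n) {a : ℝ} (ha : 2 ≤ a) :
    sphereMoment n a ≤ gaussianAbsMoment a := by
  have hn' : (0 : ℝ) < n / 2 := by positivity
  rw [sphereMoment_eq]
  refine mul_le_of_le_one_right (gaussianAbsMoment_pos (by linarith)).le ?_
  rw [div_le_one (Real.Gamma_pos_of_pos (by linarith))]
  exact Real.rpow_mul_Gamma_le_Gamma_add hn' (by linarith)

theorem sphereMoment_nonneg {n : ℕ} (hn : 0 < n) {a : ℝ} (ha : -1 < a) : 0 ≤ sphereMoment n a := by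
  have hn' : (1 : ℝ) ≤ n := by exact_mod_cast hn
  have g1 := Real.Gamma_pos_of_pos (s := (a + 1) / 2) (by linarith)
  have g2 := Real.Gamma_pos_of_pos (s := (n : ℝ) / 2) (by linarith)
  have g3 := Real.Gamma_pos_of_pos (s := ((n : ℝ) + a) / 2) (by linarith)
  unfold sphereMoment
  positivity

/-! ### Averages over the sphere of `E` -/

section SphereMean

variable {V : Type*} [NormedAddCommGroup V] [InnerProductSpace ℝ V] [FiniteDimensional ℝ V]

theorem sphereMean_eq_laverage [MeasurableSpace V] [BorelSpace V] (f : V → ℝ≥0∞) :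
    sphereMean f = ⨍⁻ u : Metric.sphere (0 : V) 1, f u ∂(volume : Measure V).toSphere := by
  obtain rfl : ‹MeasurableSpace V› = borel V := BorelSpace.measurable_eq
  rfl

/-- The uniform probability measure on the unit sphere. -/
noncomputable abbrev sphereProb (V : Type*) [NormedAddCommGroup V] [InnerProductSpace ℝ V]
    [FiniteDimensional ℝ V] [MeasurableSpace V] [BorelSpace V] :
    Measure (Metric.sphere (0 : V) 1) :=
  ((volume : Measure V).toSphere Set.univ)⁻¹ • (volume : Measure V).toSphere

theorem isProbabilityMeasure_sphereProb [MeasurableSpace V] [BorelSpace V] [Nontrivial V] :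
    IsProbabilityMeasure (sphereProb V) := by
  have : NeZero (volume : Measure V).toSphere := ⟨Measure.toSphere_ne_zero _⟩
  infer_instance

theorem sphereMean_eq_lintegral [MeasurableSpace V] [BorelSpace V] (f : V → ℝ≥0∞) :
    sphereMean f = ∫⁻ u : Metric.sphere (0 : V) 1, f u ∂sphereProb V :=
  sphereMean_eq_laverage f

theorem sphereMean_mono {f g : V → ℝ≥0∞} (h : ∀ u, ‖u‖ = 1 → f u ≤ g u) :
    sphereMean f ≤ sphereMean g := by
  borelize V
  rw [sphereMean_eq_lintegral, sphereMean_eq_lintegral]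
  exact lintegral_mono fun u => h u (by simp)

theorem sphereMean_const_add [Nontrivial V] (c : ℝ≥0∞) (f : V → ℝ≥0∞) :
    sphereMean (fun u => c + f u) = c + sphereMean f := by
  borelize V
  have := isProbabilityMeasure_sphereProb (V := V)
  rw [sphereMean_eq_lintegral, sphereMean_eq_lintegral, lintegral_add_left measurable_const]
  simp

/-- Jensen's inequality, obtained from Hölder against the constant `1`. -/
theorem sphereMean_rpow_one_div_le [Nontrivial V] {f : V → ℝ≥0∞}
    (hf : Measurable[borel V] f) {a : ℝ} (ha : 1 ≤ a) :
    sphereMean (fun u => f u ^ (1 / a)) ≤ sphereMean f ^ (1 / a) := by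
  borelize V
  have := isProbabilityMeasure_sphereProb (V := V)
  rw [sphereMean_eq_lintegral, sphereMean_eq_lintegral]
  rcases ha.eq_or_lt with rfl | ha
  · simp
  have hconj := Real.HolderConjugate.conjExponent ha
  have hf' : AEMeasurable (fun u : Metric.sphere (0 : V) 1 => f u ^ (1 / a)) (sphereProb V) :=
    ((hf.comp measurable_subtype_coe).pow_const _).aemeasurable
  have h := ENNReal.lintegral_mul_le_Lp_mul_Lq (sphereProb V) hconj hf'
    (aemeasurable_const (b := 1))
  have ha0 : a ≠ 0 := by linarith
  simpa [← ENNReal.rpow_mul, ha0] using h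

theorem lintegral_sphereProb_inner_rpow [Nontrivial V] [MeasurableSpace V] [BorelSpace V] {φ : V} (hφ : ‖φ‖ = √(Module.finrank ℝ V : ℝ))
    {a : ℝ} (ha : -1 < a) :
    ∫⁻ u : Metric.sphere (0 : V) 1, ‖inner ℝ φ (u : V)‖ₑ ^ a ∂sphereProb V =
      ENNReal.ofReal (sphereMoment (Module.finrank ℝ V) a) := by
  have hpos : 0 < ‖φ‖ := by
    rw [hφ, Real.sqrt_pos]; exact_mod_cast Module.finrank_pos (R := ℝ) (M := V)
  have he : ‖(‖φ‖⁻¹ • φ)‖ = 1 := by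
    rw [norm_smul, norm_inv, norm_norm, inv_mul_cancel₀ hpos.ne']
  have h := laverage_toSphere_inner_rpow he ha
  rw [sphereMoment, ENNReal.ofReal_mul (by positivity), ← h, laverage_eq', ← lintegral_const_mul _ (by fun_prop), ← hφ,
    ← ENNReal.ofReal_rpow_of_pos hpos]
  refine lintegral_congr fun u => ?_
  rw [inner_smul_left, enorm_mul, ← ENNReal.mul_rpow_of_ne_top ENNReal.ofReal_ne_top
    (ENNReal.mul_ne_top enorm_ne_top enorm_ne_top), ← mul_assoc]
  have h1 : ENNReal.ofReal ‖φ‖ * ‖(starRingEnd ℝ) ‖φ‖⁻¹‖ₑ = 1 := by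
    rw [← ofReal_norm, ← ENNReal.ofReal_mul (norm_nonneg _)]
    simp [hpos.ne']
  rw [h1, one_mul]

variable {M : Type*} [TopologicalSpace M] [MeasurableSpace M]
  [OpensMeasurableSpace M] {μ : Measure M} {φ : M → V}

theorem measurable_uncurry_enorm_inner_rpow [MeasurableSpace V] [BorelSpace V]
    (hφ : Continuous φ) (a : ℝ) :
    Measurable (Function.uncurry fun (u : V) (p : M) => ‖inner ℝ (φ p) u‖ₑ ^ a) := by
  have h1 : Measurable fun q : V × M => φ q.2 := hφ.measurable.comp measurable_snd
  have h2 : Measurable fun q : V × M => q.1 := measurable_fst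
  exact (h1.inner h2).enorm.pow_const a

theorem measurable_lintegral_enorm_inner_rpow [SFinite μ] (hφ : Continuous φ) (a : ℝ) :
    Measurable[borel V] fun u : V => ∫⁻ p, ‖inner ℝ (φ p) u‖ₑ ^ a ∂μ := by
  borelize V
  exact (measurable_uncurry_enorm_inner_rpow hφ a).lintegral_prod_right'

theorem sphereMean_lintegral_inner_rpow [Nontrivial V] [IsProbabilityMeasure μ]
    (hφ : Continuous φ) (hnorm : ∀ p, ‖φ p‖ = √(Module.finrank ℝ V : ℝ)) {a : ℝ} (ha : -1 < a) :
    sphereMean (fun u => ∫⁻ p, ‖inner ℝ (φ p) u‖ₑ ^ a ∂μ) =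
      ENNReal.ofReal (sphereMoment (Module.finrank ℝ V) a) := by
  borelize V
  have := isProbabilityMeasure_sphereProb (V := V)
  have hm := measurable_uncurry_enorm_inner_rpow hφ a
  rw [sphereMean_eq_lintegral, lintegral_lintegral_swap]
  · simp_rw [lintegral_sphereProb_inner_rpow (hnorm _) ha]
    simp
  · exact (hm.comp ((measurable_subtype_coe.comp measurable_fst).prodMk
      measurable_snd)).aemeasurable

omit [TopologicalSpace M] [MeasurableSpace M] [OpensMeasurableSpace M] in
/-- The expected maximum of finitely many functionals of length `√(dim V)` over the sphere. -/
theorem sphereMean_finset_sup_enorm_inner_le [Nontrivial V]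
    (hnorm : ∀ p, ‖φ p‖ = √(Module.finrank ℝ V : ℝ)) (t : Finset M) {a : ℝ} (ha : 1 ≤ a) :
    sphereMean (fun u => t.sup fun p => ‖inner ℝ (φ p) u‖ₑ) ≤
      (t.card * ENNReal.ofReal (sphereMoment (Module.finrank ℝ V) a)) ^ (1 / a) := by
  have ha0 : 0 < a := by linarith
  -- A maximum is at most the `ℓ^a` norm, whose `a`-th power averages to `card t` equal moments.
  have h1 : sphereMean (fun u => t.sup fun p => ‖inner ℝ (φ p) u‖ₑ) ≤
      sphereMean (fun u => (∑ p ∈ t, ‖inner ℝ (φ p) u‖ₑ ^ a) ^ (1 / a)) := by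
    refine sphereMean_mono fun u _ => Finset.sup_le fun p hp => ?_
    rw [one_div, ENNReal.le_rpow_inv_iff ha0]
    exact Finset.single_le_sum (f := fun p => ‖inner ℝ (φ p) u‖ₑ ^ a) (fun _ _ => zero_le) hp
  refine h1.trans ((sphereMean_rpow_one_div_le ?_ ha).trans_eq ?_)
  · borelize V
    fun_prop
  · congr 1
    borelize V
    rw [sphereMean_eq_lintegral, lintegral_finsetSum _ fun p _ => by fun_prop]
    simp_rw [lintegral_sphereProb_inner_rpow (hnorm _) (by linarith : -1 < a)]
    simp

end SphereMean

/-- Closing arithmetic for the sup norm: `a = 2 + C + d ℓ`, the term `1` bounds `κ ε`, and `√(x + y)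
≤ √x + √y` separates `√ℓ`. -/
theorem one_add_exp_mul_sqrt_lt {C ℓ : ℝ} (hC : 0 ≤ C) (hℓ : 0 ≤ ℓ) (d : ℕ) :
    1 + Real.exp 1 * √((2 + C + d * ℓ + 1) / Real.exp 1) <
      (2 + √(Real.exp 1 * (3 + C)) + √(Real.exp 1 * d)) * (√ℓ + 1) := by
  have he := Real.exp_pos 1
  have h1 : Real.exp 1 * √((2 + C + d * ℓ + 1) / Real.exp 1) =
      √(Real.exp 1 * (3 + C) + Real.exp 1 * d * ℓ) := by
    conv_lhs => rw [← Real.sqrt_sq he.le]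
    rw [← Real.sqrt_mul (by positivity)]
    congr 1
    rw [Real.sqrt_sq he.le]
    field_simp
    ring
  have h2 : √(Real.exp 1 * (3 + C) + Real.exp 1 * d * ℓ) ≤
      √(Real.exp 1 * (3 + C)) + √(Real.exp 1 * d) * √ℓ := by
    rw [← Real.sqrt_mul (by positivity)]
    refine Real.sqrt_le_iff.2 ⟨by positivity, ?_⟩
    have h3 : 0 ≤ √(Real.exp 1 * (3 + C)) * √(Real.exp 1 * d * ℓ) := by positivity
    rw [add_sq, Real.sq_sqrt (by positivity), Real.sq_sqrt (by positivity)]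
    linarith
  rw [h1]
  have h3 := Real.sqrt_nonneg ℓ
  have h4 := Real.sqrt_nonneg (Real.exp 1 * (3 + C))
  have h5 := Real.sqrt_nonneg (Real.exp 1 * d)
  nlinarith [mul_nonneg h4 h3]

/-! ### The norm estimates -/

namespace InvSpace

section Basic

variable {G M : Type*} [SMul G M] [MeasurableSpace M] {μ : Measure M}

theorem nontrivial_carrier (E : InvSpace G μ) : Nontrivial E.carrier :=
  Submodule.nontrivial_iff_ne_bot.2 E.ne_bot

theorem dim_pos [TopologicalSpace M] (E : InvSpace G μ) : 0 < E.dim :=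
  have := E.nontrivial_carrier
  Module.finrank_pos

end Basic

variable {G M : Type*} [Group G] [TopologicalSpace G] [IsTopologicalGroup G] [CompactSpace G]
  [MetricSpace M] [CompactSpace M] [MeasurableSpace M] [BorelSpace M]
  [MulAction G M] [ContinuousSMul G M] [MulAction.IsPretransitive G M]
  {μ : Measure M} [IsProbabilityMeasure μ] [SMulInvariantMeasure G M μ]

theorem mean_lintegral_rpow (E : InvSpace G μ) {a : ℝ} (ha : -1 < a) :
    E.mean (fun u => ∫⁻ p, ‖u p‖ₑ ^ a ∂μ) = ENNReal.ofReal (sphereMoment E.dim a) := by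
  have := E.nontrivial_carrier
  have h : ∀ u : E.carrier, ∫⁻ p, ‖(u : Lp ℝ 2 μ) p‖ₑ ^ a ∂μ =
      ∫⁻ p, ‖inner ℝ (E.evalVec p) u‖ₑ ^ a ∂μ := fun u => lintegral_congr_ae <| by
    filter_upwards [(E.evalVec_spec u).2] with p hp
    rw [hp]
  rw [mean]
  simp_rw [h]
  exact sphereMean_lintegral_inner_rpow E.continuous_evalVec E.norm_evalVec ha

theorem mean_eLpNorm_le (E : InvSpace G μ) {a : ℝ} (ha : 1 ≤ a) :
    E.mean (fun u => eLpNorm u (ENNReal.ofReal a) μ) ≤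
      ENNReal.ofReal (sphereMoment E.dim a) ^ (1 / a) := by
  have := E.nontrivial_carrier
  have ha0 : 0 < a := by linarith
  have h : ∀ u : E.carrier, eLpNorm (u : Lp ℝ 2 μ) (ENNReal.ofReal a) μ =
      (∫⁻ p, ‖inner ℝ (E.evalVec p) u‖ₑ ^ a ∂μ) ^ (1 / a) := by
    intro u
    rw [eLpNorm_congr_ae (E.evalVec_spec u).2,
      eLpNorm_eq_lintegral_rpow_enorm_toReal (by simpa using ha0) ENNReal.ofReal_ne_top,
      ENNReal.toReal_ofReal ha0.le]
  rw [mean]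
  simp_rw [h]
  refine (sphereMean_rpow_one_div_le
    (measurable_lintegral_enorm_inner_rpow E.continuous_evalVec a) ha).trans_eq ?_
  rw [sphereMean_lintegral_inner_rpow E.continuous_evalVec E.norm_evalVec (by linarith)]
  rfl

theorem tendsto_mean_lintegral_rpow {E : ℕ → InvSpace G μ}
    (hE : Tendsto (fun n => (E n).dim) atTop atTop) {a : ℝ} (ha : -1 < a) :
    Tendsto (fun n => (E n).mean (fun u => ∫⁻ p, ‖u p‖ₑ ^ a ∂μ)) atTop
      (𝓝 (ENNReal.ofReal (gaussianAbsMoment a))) := by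
  simp_rw [fun n => (E n).mean_lintegral_rpow ha]
  exact ENNReal.tendsto_ofReal ((tendsto_sphereMoment ha).comp hE)

theorem limsup_mean_eLpNorm_le {E : ℕ → InvSpace G μ}
    (hE : Tendsto (fun n => (E n).dim) atTop atTop) {a : ℝ} (ha : 1 ≤ a) :
    limsup (fun n => (E n).mean (fun u => eLpNorm u (ENNReal.ofReal a) μ)) atTop ≤
      ENNReal.ofReal (gaussianAbsMoment a ^ (1 / a)) := by
  have h1 : Tendsto (fun n => ENNReal.ofReal (sphereMoment (E n).dim a) ^ (1 / a)) atTop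
      (𝓝 (ENNReal.ofReal (gaussianAbsMoment a) ^ (1 / a))) :=
    (ENNReal.continuous_rpow_const.tendsto _).comp
      (ENNReal.tendsto_ofReal ((tendsto_sphereMoment (by linarith)).comp hE))
  rw [← ENNReal.ofReal_rpow_of_pos (gaussianAbsMoment_pos (by linarith)), ← h1.limsup_eq]
  exact limsup_le_limsup (.of_forall fun n => (E n).mean_eLpNorm_le ha)

theorem mean_eLpNorm_lt (E : InvSpace G μ) {a : ℝ} (ha : 2 ≤ a) :
    E.mean (fun u => eLpNorm u (ENNReal.ofReal a) μ) < ENNReal.ofReal √((a + 1) / Real.exp 1) := by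
  refine (E.mean_eLpNorm_le (by linarith)).trans_lt ?_
  rw [ENNReal.ofReal_rpow_of_nonneg (sphereMoment_nonneg E.dim_pos (by linarith))
    (by have : 0 < a := by linarith
        positivity), ENNReal.ofReal_lt_ofReal_iff (by positivity)]
  refine lt_of_le_of_lt ?_ (gaussianAbsMoment_rpow_one_div_lt (by linarith : 1 ≤ a))
  exact Real.rpow_le_rpow (sphereMoment_nonneg E.dim_pos (by linarith))
    (sphereMoment_le E.dim_pos ha) (by have : 0 < a := by linarith
                                       positivity)

theorem eLpNorm_top_le_add_sup (E : InvSpace G μ) {t : Finset M} {ε κ : ℝ}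
    (hκ : 0 ≤ κ) (hlip : ∀ p q, ‖E.evalVec p - E.evalVec q‖ ≤ κ * dist p q)
    (ht : ∀ p, ∃ q ∈ t, dist p q ≤ ε) (u : E.carrier) (hu : ‖u‖ = 1) :
    eLpNorm (u : Lp ℝ 2 μ) ∞ μ ≤
      ENNReal.ofReal (κ * ε) + t.sup fun p => ‖inner ℝ (E.evalVec p) u‖ₑ := by
  rw [eLpNorm_congr_ae (E.evalVec_spec u).2, eLpNorm_exponent_top]
  refine eLpNormEssSup_le_of_ae_enorm_bound (.of_forall fun p => ?_)
  obtain ⟨q, hq, hpq⟩ := ht p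
  have h1 : inner ℝ (E.evalVec p) u = inner ℝ (E.evalVec p - E.evalVec q) u +
      inner ℝ (E.evalVec q) u := by
    rw [← inner_add_left, sub_add_cancel]
  rw [h1]
  refine (enorm_add_le _ _).trans (add_le_add ?_ ?_)
  · rw [← ofReal_norm]
    refine ENNReal.ofReal_le_ofReal ((norm_inner_le_norm _ _).trans ?_)
    rw [hu, mul_one]
    exact (hlip p q).trans (by gcongr)
  · exact Finset.le_sup (f := fun p => ‖inner ℝ (E.evalVec p) u‖ₑ) hq

theorem mean_eLpNorm_top_le (E : InvSpace G μ) {t : Finset M} {ε κ : ℝ} (hε : 0 ≤ ε)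
    (hκ : 0 ≤ κ) (hlip : ∀ p q, ‖E.evalVec p - E.evalVec q‖ ≤ κ * dist p q)
    (ht : ∀ p, ∃ q ∈ t, dist p q ≤ ε) {a : ℝ} (ha : 2 ≤ a) (hta : (t.card : ℝ) ≤ Real.exp a) :
    E.mean (fun u => eLpNorm u ∞ μ) ≤
      ENNReal.ofReal (κ * ε + Real.exp 1 * √((a + 1) / Real.exp 1)) := by
  have := E.nontrivial_carrier
  have ha0 : 0 < a := by linarith
  have hS := sphereMoment_nonneg E.dim_pos (by linarith : -1 < a)
  calc E.mean (fun u => eLpNorm u ∞ μ)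
      ≤ sphereMean (fun u : E.carrier => ENNReal.ofReal (κ * ε) +
          t.sup fun p => ‖inner ℝ (E.evalVec p) u‖ₑ) :=
        sphereMean_mono fun u hu => E.eLpNorm_top_le_add_sup hκ hlip ht u hu
    _ ≤ ENNReal.ofReal (κ * ε) +
          (t.card * ENNReal.ofReal (sphereMoment E.dim a)) ^ (1 / a) := by
        rw [sphereMean_const_add]
        gcongr
        exact sphereMean_finset_sup_enorm_inner_le E.norm_evalVec t (by linarith)
    _ ≤ _ := by
        rw [ENNReal.ofReal_add (by positivity) (by positivity), ← ENNReal.ofReal_natCast,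
          ← ENNReal.ofReal_mul (by positivity),
          ENNReal.ofReal_rpow_of_nonneg (by positivity) (by positivity)]
        gcongr
        rw [Real.mul_rpow (by positivity) hS]
        -- With `a` at least the logarithm of the size of the net, passing to the maximum costs only
        -- a factor `e`.
        have h1 : (t.card : ℝ) ^ (1 / a) ≤ Real.exp 1 := by
          refine (Real.rpow_le_rpow (by positivity) hta (by positivity)).trans_eq ?_
          rw [← Real.exp_mul, mul_one_div_cancel ha0.ne']
        have h2 : sphereMoment E.dim a ^ (1 / a) ≤ √((a + 1) / Real.exp 1) :=
          (Real.rpow_le_rpow hS (sphereMoment_le E.dim_pos ha) (by positivity)).trans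
            (gaussianAbsMoment_rpow_one_div_lt (by linarith)).le
        gcongr

theorem iota_smul (E : InvSpace G μ) (g : G) (p : M) : E.iota (g • p) = E.rep g (E.iota p) := by
  rw [iota, iota, E.evalVec_smul, E.norm_rep_apply, map_smul]

theorem evalVec_eq_smul_iota (E : InvSpace G μ) (p : M) :
    E.evalVec p = √(E.dim : ℝ) • E.iota p := by
  have h : √(E.dim : ℝ) ≠ 0 := (Real.sqrt_pos.2 (by exact_mod_cast E.dim_pos)).ne'
  rw [iota, E.norm_evalVec, smul_smul, mul_inv_cancel₀ h, one_smul]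

end InvSpace

theorem exists_bound_mean_eLpNorm_top {m k : ℕ}
    {M : Type*} [MetricSpace M] [ChartedSpace (EuclideanSpace ℝ (Fin m)) M]
    [IsManifold (𝓡 m) ∞ M]
    [RiemannianBundle (fun p : M => TangentSpace (𝓡 m) p)]
    [IsContMDiffRiemannianBundle (𝓡 m) ∞ (EuclideanSpace ℝ (Fin m))
      (fun p : M => TangentSpace (𝓡 m) p)]
    [IsRiemannianManifold (𝓡 m) M] [CompactSpace M]
    [MeasurableSpace M] [BorelSpace M]
    {G : Type*} [Group G] [TopologicalSpace G] [ChartedSpace (EuclideanSpace ℝ (Fin k)) G]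
    [LieGroup (𝓡 k) ∞ G] [CompactSpace G]
    [MulAction G M] [ContMDiffSMul (𝓡 k) (𝓡 m) ∞ G M] [MulAction.IsPretransitive G M]
    (hiso : ActsByIsometries m G M)
    (o : M) (hirr : IsotropyIrreducible m G o)
    (μ : Measure M) [IsProbabilityMeasure μ] [SMulInvariantMeasure G M μ] :
    ∃ K : ℝ, 0 < K ∧ ∀ E : InvSpace G μ, ∃ s : ℝ, E.IsDilationCoeff m s ∧
      E.mean (fun u => eLpNorm u ∞ μ)
        < ENNReal.ofReal (K * (√(max (Real.log (√(E.dim : ℝ) * s)) 0) + 1)) := by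
  have : IsTopologicalGroup G := topologicalGroup_of_lieGroup (𝓡 k) ∞
  have : ContinuousSMul G M := ContMDiffSMul.continuousSMul (I := 𝓡 k) (I' := 𝓡 m) ∞
  obtain ⟨C₀, hC₀, hcover⟩ := exists_finset_cover_of_isRiemannianManifold (m := m) (M := M)
  set C : ℝ := Real.log (max C₀ 1)
  have hC : 0 ≤ C := Real.log_nonneg (le_max_right _ _)
  refine ⟨2 + √(Real.exp 1 * (3 + C)) + √(Real.exp 1 * m), by positivity, fun E => ?_⟩
  have hsmooth : ContMDiff (𝓡 m) 𝓘(ℝ, E.carrier) 1 E.iota :=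
    contMDiff_of_equivariant (k := k) E.continuous_rep E.norm_rep_apply
      (continuous_of_equivariant E.continuous_rep E.iota_smul) E.iota_smul
  obtain ⟨s, hs, hds⟩ := exists_norm_mfderiv_eq_mul_norm
    (fun g : G => ContMDiffSMul.contMDiff_const_smul (I := 𝓡 k) g) hiso hirr E.norm_rep_apply
    hsmooth E.iota_smul
  refine ⟨s, ⟨hsmooth.mdifferentiable one_ne_zero, hds⟩, ?_⟩
  set κ : ℝ := √(E.dim : ℝ) * s
  have hκ : 0 ≤ κ := by positivity
  have hlip : ∀ p q, ‖E.evalVec p - E.evalVec q‖ ≤ κ * dist p q := by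
    intro p q
    rw [E.evalVec_eq_smul_iota, E.evalVec_eq_smul_iota q, ← smul_sub, norm_smul,
      Real.norm_of_nonneg (Real.sqrt_nonneg _), mul_assoc, dist_comm]
    gcongr
    exact norm_sub_le_mul_dist_of_norm_mfderiv_le hsmooth hs (fun p v => (hds p v).le) q p
  set ℓ : ℝ := max (Real.log κ) 0
  have hℓ : 0 ≤ ℓ := le_max_right _ _
  -- The case `κ = 0` is separate, since `Real.log 0 = 0` carries no information.
  have hκℓ : κ ≤ Real.exp ℓ := by
    rcases hκ.eq_or_lt with h | h
    · rw [← h]; positivity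
    · rw [← Real.log_le_iff_le_exp h]; exact le_max_left _ _
  -- For `κ > 0` the mesh `exp (-ℓ)` is `min 1 (1 / κ)`: small enough for `κ ε ≤ 1`, and at most `1`
  -- as the covering bound requires.
  obtain ⟨t, htc, ht⟩ := hcover (Real.exp (-ℓ)) (Real.exp_pos _) (Real.exp_le_one_iff.2 (by linarith))
  -- The exponent serves as `a`; the summand `2` only ensures `a ≥ 2`.
  have hcard : (t.card : ℝ) ≤ Real.exp (2 + C + m * ℓ) := by
    have h1 : 1 / Real.exp (-ℓ) = Real.exp ℓ := by rw [Real.exp_neg, one_div, inv_inv]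
    rw [h1, ← Real.exp_nat_mul] at htc
    have h2 : C₀ ≤ Real.exp (2 + C) := by
      have h3 : max C₀ 1 = Real.exp C := (Real.exp_log (by positivity)).symm
      calc C₀ ≤ max C₀ 1 := le_max_left _ _
        _ = Real.exp C := h3
        _ ≤ _ := Real.exp_le_exp.2 (by linarith)
    calc (t.card : ℝ) ≤ _ := htc
      _ ≤ Real.exp (2 + C) * Real.exp (m * ℓ) := by gcongr
      _ = _ := (Real.exp_add _ _).symm
  refine (E.mean_eLpNorm_top_le (Real.exp_pos _).le hκ hlip ht ?_ hcard).trans_lt ?_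
  · have : 0 ≤ (m : ℝ) * ℓ := by positivity
    linarith
  · rw [ENNReal.ofReal_lt_ofReal_iff (by positivity)]
    refine lt_of_le_of_lt ?_ (one_add_exp_mul_sqrt_lt hC hℓ m)
    gcongr
    rw [Real.exp_neg, ← div_eq_mul_inv]
    exact (div_le_one (Real.exp_pos _)).2 hκℓ

theorem mainTheorem3 {m k : ℕ}
    {M : Type*} [MetricSpace M] [ChartedSpace (EuclideanSpace ℝ (Fin m)) M]
    [IsManifold (𝓡 m) ∞ M]
    [RiemannianBundle (fun p : M => TangentSpace (𝓡 m) p)]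
    [IsContMDiffRiemannianBundle (𝓡 m) ∞ (EuclideanSpace ℝ (Fin m))
      (fun p : M => TangentSpace (𝓡 m) p)]
    [IsRiemannianManifold (𝓡 m) M] [CompactSpace M] [ConnectedSpace M]
    [MeasurableSpace M] [BorelSpace M]
    {G : Type*} [Group G] [TopologicalSpace G] [ChartedSpace (EuclideanSpace ℝ (Fin k)) G]
    [LieGroup (𝓡 k) ∞ G] [CompactSpace G]
    [MulAction G M] [ContMDiffSMul (𝓡 k) (𝓡 m) ∞ G M] [MulAction.IsPretransitive G M]
    (hiso : ActsByIsometries m G M)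
    (o : M) (hirr : IsotropyIrreducible m G o)
    (μ : Measure M) [IsProbabilityMeasure μ] [SMulInvariantMeasure G M μ] :
    (∀ E : ℕ → InvSpace G μ, Tendsto (fun n => (E n).dim) atTop atTop →
      (∀ a : ℝ, -1 < a →
        Tendsto (fun n => (E n).mean (fun u => ∫⁻ p, ‖u p‖ₑ ^ a ∂μ)) atTop
          (𝓝 (ENNReal.ofReal ((2 : ℝ) ^ (a / 2) / √Real.pi * Real.Gamma ((a + 1) / 2))))) ∧
      (∀ a : ℝ, 1 ≤ a →
        limsup (fun n => (E n).mean (fun u => eLpNorm u (ENNReal.ofReal a) μ)) atTop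
          ≤ ENNReal.ofReal
              (√2 * Real.pi ^ (-(1 / (2 * a))) * Real.Gamma ((a + 1) / 2) ^ (1 / a)) ∧
        √2 * Real.pi ^ (-(1 / (2 * a))) * Real.Gamma ((a + 1) / 2) ^ (1 / a)
          < √((a + 1) / Real.exp 1))) ∧
    (∀ E : InvSpace G μ, ∀ a : ℝ, 2 ≤ a →
      E.mean (fun u => eLpNorm u (ENNReal.ofReal a) μ)
        < ENNReal.ofReal √((a + 1) / Real.exp 1)) ∧
    (∃ K : ℝ, 0 < K ∧ ∀ E : InvSpace G μ, ∃ s : ℝ, E.IsDilationCoeff m s ∧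
      E.mean (fun u => eLpNorm u ∞ μ)
        < ENNReal.ofReal (K * (√(max (Real.log (√(E.dim : ℝ) * s)) 0) + 1))) := by
  have : IsTopologicalGroup G := topologicalGroup_of_lieGroup (𝓡 k) ∞
  have : ContinuousSMul G M := ContMDiffSMul.continuousSMul (I := 𝓡 k) (I' := 𝓡 m) ∞
  refine ⟨fun E hE => ⟨fun a ha => InvSpace.tendsto_mean_lintegral_rpow hE ha, fun a ha => ?_⟩,
    fun E a ha => E.mean_eLpNorm_lt ha, exists_bound_mean_eLpNorm_top (k := k) hiso o hirr μ⟩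
  rw [← gaussianAbsMoment_rpow_one_div (by linarith)]
  exact ⟨InvSpace.limsup_mean_eLpNorm_le hE ha, gaussianAbsMoment_rpow_one_div_lt ha⟩
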